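/- Let $\Omega\subset\mathbb R^d$, $d\in\{1,2,3\}$, be a bounded connected open set with $C^\infty$ boundary and let $c\in L^\infty(\Omega)$. Assume that the spectrum of $\mathcal A=-\Delta+c:H^1_0(\Omega)\to H^{-1}(\Omega)$ is simple, let $(\lambda_k)_{k\ge 1}$ be an enumeration of it, and let $(\phi_k)_{k\ge 1}$ be corresponding eigenfunctions (continuous representatives), forming an orthonormal basis of $L^2(\Omega)$. Let $x_{\rm con},x_{\rm obs}\in\Omega$, let $N\ge 1$, and put $$A_N=\operatorname{diag}(-\lambda_1,\dots,-\lambda_N),\qquad B_N=\begin{bmatrix}\phi_1(x_{\rm con})\\ \vdots\\ \phi_N(x_{\rm con})\end{bmatrix},\qquad C_N=\begin{bmatrix}\phi_1(x_{\rm obs})&\cdots&\phi_N(x_{\rm obs})\end{bmatrix}.$$ **$C$-turnpike.** For real matrices $A$ ($n\times n$), $B$ ($n\times m$), $C$ ($p\times n$), let $\mathscr L^{0+}(A)\subseteq\mathbb R^n$ be the $A$-invariant subspace spanned by the generalized eigenvectors of $A$ for eigenvalues with nonnegative real part, and let $D$ be the orthogonal projection of $\mathbb R^n$ onto the detectable space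 $\big(\bigcap_{i=0}^{n-1}\ker(CA^i)\cap\mathscr L^{0+}(A)\big)^\perp$. The triplet $(A,B,C)$ enjoys $C$-turnpike if there is $\mu>0$ such that for all $x_0\in\mathbb R^n$ and $z\in\mathbb R^p$ there is $K$ such that for every $T>0$ and a.e. $t\in(0,T)$ $$\|u^T(t)-\overline u\|+\|Dx^T(t)-D\overline x\|\le K\left[e^{-\mu t}+e^{-\mu(T-t)}\right].$$ Here $(u^T,x^T)$ is the optimal pair for minimizing $\frac12\int_0^T\left[\|u\|^2+\|Cx-z\|^2\right]dt$ over $u\in L^2(0,T;\mathbb R^m)$ with $\dot x=Ax+Bu$ on $(0,T)$, $x(0)=x_0$, and $(\overline u,\overline x)$ is any minimizer of $\frac12\left[\|u\|^2+\|Cx-z\|^2\right]$ subject to $0=Ax+Bu$. **Proposition 1.2.** Consider the condition (P) for every $i\in\{1,\dots,N\}$ with $\phi_i(x_{\rm obs})\ne 0$, either $\phi_i(x_{\rm con})\neq 0$ or $\lambda_i>0$. 1. If $(A_N,B_N,C_N)$ enjoys $C_N$-turnpike, then (P) holds. 2. Conversely, assume that $\lambda_i\neq0$ for every $i\in\{1,\dots,N\}$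 with $\phi_i(x_{\rm obs})=0$ and $\phi_i(x_{\rm con})\ne0$. If (P) holds, then $(A_N,B_N,C_N)$ enjoys $C_N$-turnpike. In particular, under the assumption in 2, $(A_N,B_N,C_N)$ enjoys $C_N$-turnpike if and only if (P) holds. -/

import Mathlib

open MeasureTheory Set
open scoped ENNReal ContDiff

namespace PointHeat

noncomputable section

/-! ### Domains and the space `H¹₀(Ω)` -/

/-- `Ω` has `C^∞` boundary: near each boundary point, `Ω` is the sublevel set `{ρ < 0}` of a smooth
function `ρ` whose differential does not vanish at that point. -/
def HasSmoothBoundary {d : ℕ} (Ω : Set (EuclideanSpace ℝ (Fin d))) : Prop :=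
  ∀ x ∈ frontier Ω, ∃ U : Set (EuclideanSpace ℝ (Fin d)), IsOpen U ∧ x ∈ U ∧
    ∃ ρ : EuclideanSpace ℝ (Fin d) → ℝ,
      ContDiffOn ℝ ∞ ρ U ∧ fderiv ℝ ρ x ≠ 0 ∧ Ω ∩ U = {y ∈ U | ρ y < 0}

/-- The Lebesgue measure on `Ω`. -/
abbrev vol {d : ℕ} (Ω : Set (EuclideanSpace ℝ (Fin d))) : Measure (EuclideanSpace ℝ (Fin d)) :=
  (volume : Measure (EuclideanSpace ℝ (Fin d))).restrict Ω

/-- `L²(Ω)`. -/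
abbrev L2 {d : ℕ} (Ω : Set (EuclideanSpace ℝ (Fin d))) : Type :=
  Lp ℝ 2 (vol Ω)

/-- `L²(Ω) × L²(Ω; ℝᵈ)`, in which a function is recorded together with its gradient. The norm of
`(u, ∇u)` in this space is the `H¹` norm of `u`. -/
abbrev GraphSpace {d : ℕ} (Ω : Set (EuclideanSpace ℝ (Fin d))) : Type :=
  WithLp 2 (L2 Ω × Lp (EuclideanSpace ℝ (Fin d)) 2 (vol Ω))

/-- The pairs `(f, ∇f)` for test functions `f ∈ C_c^∞(Ω)`. -/
def testGraphs {d : ℕ} (Ω : Set (EuclideanSpace ℝ (Fin d))) : Set (GraphSpace Ω) :=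
  {w | ∃ f : EuclideanSpace ℝ (Fin d) → ℝ, ContDiff ℝ ∞ f ∧ HasCompactSupport f ∧ tsupport f ⊆ Ω ∧
    w.fst =ᵐ[vol Ω] f ∧ w.snd =ᵐ[vol Ω] gradient f}

/-- The Sobolev space `H¹₀(Ω)`: the closure of `C_c^∞(Ω)` in the `H¹` norm. -/
def H10 {d : ℕ} (Ω : Set (EuclideanSpace ℝ (Fin d))) : Submodule ℝ (GraphSpace Ω) :=
  (Submodule.span ℝ (testGraphs Ω)).topologicalClosure

/-- The inclusion `H¹₀(Ω) → L²(Ω)`. -/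
def toL2 {d : ℕ} (Ω : Set (EuclideanSpace ℝ (Fin d))) : H10 Ω →L[ℝ] L2 Ω :=
  (WithLp.fstL 2 ℝ (L2 Ω) (Lp (EuclideanSpace ℝ (Fin d)) 2 (vol Ω))).comp (H10 Ω).subtypeL

/-- The weak gradient `H¹₀(Ω) → L²(Ω; ℝᵈ)`. -/
def weakGrad {d : ℕ} (Ω : Set (EuclideanSpace ℝ (Fin d))) :
    H10 Ω →L[ℝ] Lp (EuclideanSpace ℝ (Fin d)) 2 (vol Ω) :=
  (WithLp.sndL 2 ℝ (L2 Ω) (Lp (EuclideanSpace ℝ (Fin d)) 2 (vol Ω))).comp (H10 Ω).subtypeL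

/-! ### The operator `-Δ + c` and its spectrum -/

/-- `H⁻¹(Ω)`, the dual of `H¹₀(Ω)`. -/
abbrev HMinus1 {d : ℕ} (Ω : Set (EuclideanSpace ℝ (Fin d))) : Type :=
  StrongDual ℝ (H10 Ω)

/-- The embedding `H¹₀(Ω) → H⁻¹(Ω)`, `u ↦ (v ↦ ∫_Ω u v)`. -/
def embed {d : ℕ} (Ω : Set (EuclideanSpace ℝ (Fin d))) : H10 Ω →ₗ[ℝ] HMinus1 Ω where
  toFun u := (innerSL ℝ (toL2 Ω u)).comp (toL2 Ω)
  map_add' u v := by ext w; simp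
  map_smul' r u := by ext w; simp

/-- Multiplication by `c ∈ L^∞(Ω)` on `L²(Ω)`. -/
def mulPotential {d : ℕ} (Ω : Set (EuclideanSpace ℝ (Fin d))) (c : Lp ℝ ∞ (vol Ω)) :
    L2 Ω →L[ℝ] L2 Ω :=
  (ContinuousLinearMap.mul ℝ ℝ).holderL (vol Ω) ∞ 2 2 c

/-- The operator `-Δ + c : H¹₀(Ω) → H⁻¹(Ω)`, `u ↦ (v ↦ ∫_Ω ∇u · ∇v + c u v)`. -/
def schrodinger {d : ℕ} (Ω : Set (EuclideanSpace ℝ (Fin d))) (c : Lp ℝ ∞ (vol Ω)) :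
    H10 Ω →ₗ[ℝ] HMinus1 Ω where
  toFun u := (innerSL ℝ (weakGrad Ω u)).comp (weakGrad Ω) +
    (innerSL ℝ (mulPotential Ω c (toL2 Ω u))).comp (toL2 Ω)
  map_add' u v := by ext w; simp; ring
  map_smul' r u := by ext w; simp

/-- The shifted operator `-Δ + c - μ : H¹₀(Ω) → H⁻¹(Ω)`. -/
def shifted {d : ℕ} (Ω : Set (EuclideanSpace ℝ (Fin d))) (c : Lp ℝ ∞ (vol Ω)) (μ : ℝ) :
    H10 Ω →ₗ[ℝ] HMinus1 Ω :=
  schrodinger Ω c - μ • embed Ω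

/-- The (real) spectrum of `-Δ + c`: the `μ` for which `-Δ + c - μ : H¹₀(Ω) → H⁻¹(Ω)` is not
bijective. -/
def dirichletSpectrum {d : ℕ} (Ω : Set (EuclideanSpace ℝ (Fin d))) (c : Lp ℝ ∞ (vol Ω)) : Set ℝ :=
  {μ | ¬ Function.Bijective (shifted Ω c μ)}

/-- The spectrum of `-Δ + c` is simple: it consists of eigenvalues of multiplicity one. -/
def HasSimpleSpectrum {d : ℕ} (Ω : Set (EuclideanSpace ℝ (Fin d))) (c : Lp ℝ ∞ (vol Ω)) : Prop :=
  ∀ μ ∈ dirichletSpectrum Ω c, Module.finrank ℝ (LinearMap.ker (shifted Ω c μ)) = 1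

/-- `lam 0, lam 1, …` is an enumeration of the spectrum of `-Δ + c`, and `φ 0, φ 1, …` are
corresponding eigenfunctions which form an orthonormal basis of `L²(Ω)`. Each `φ k` is the
continuous representative of the eigenfunction, so that its values at points of `Ω` make sense. No
order of the enumeration is imposed. -/
def IsEigenbasis {d : ℕ} (Ω : Set (EuclideanSpace ℝ (Fin d))) (c : Lp ℝ ∞ (vol Ω))
    (lam : ℕ → ℝ) (φ : ℕ → EuclideanSpace ℝ (Fin d) → ℝ) : Prop :=
  range lam = dirichletSpectrum Ω c ∧
  (∀ k, ContinuousOn (φ k) Ω) ∧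
  ∃ e : ℕ → H10 Ω,
    (∀ k, φ k =ᵐ[vol Ω] toL2 Ω (e k)) ∧
    (∀ k, schrodinger Ω c (e k) = lam k • embed Ω (e k)) ∧
    Orthonormal ℝ (fun k => toL2 Ω (e k)) ∧
    (Submodule.span ℝ (range fun k => toL2 Ω (e k))).topologicalClosure = ⊤

/-! ### The linear quadratic problem -/

/-- The action of a matrix on Euclidean vectors. -/
abbrev act {p q : ℕ} (M : Matrix (Fin p) (Fin q) ℝ) :
    EuclideanSpace ℝ (Fin q) →ₗ[ℝ] EuclideanSpace ℝ (Fin p) :=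
  Matrix.toEuclideanLin M

/-- `u ∈ L²(0,T;ℝᵐ)` is a control and `x` is the solution on `[0,T]` of `ẋ = A x + B u`,
`x(0) = x₀` (in integrated form). -/
def IsTrajectory {n m : ℕ} (A : Matrix (Fin n) (Fin n) ℝ) (B : Matrix (Fin n) (Fin m) ℝ)
    (x₀ : EuclideanSpace ℝ (Fin n)) (T : ℝ)
    (u : ℝ → EuclideanSpace ℝ (Fin m)) (x : ℝ → EuclideanSpace ℝ (Fin n)) : Prop :=
  MemLp u 2 (volume.restrict (Ioo 0 T)) ∧
  ContinuousOn x (Icc 0 T) ∧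
  ∀ t ∈ Icc 0 T, x t = x₀ + ∫ s in (0 : ℝ)..t, (act A (x s) + act B (u s))

/-- The cost `½ ∫₀ᵀ (‖u‖² + ‖C x - z‖²) dt`. -/
def cost {n m p : ℕ} (C : Matrix (Fin p) (Fin n) ℝ) (z : EuclideanSpace ℝ (Fin p)) (T : ℝ)
    (u : ℝ → EuclideanSpace ℝ (Fin m)) (x : ℝ → EuclideanSpace ℝ (Fin n)) : ℝ :=
  1 / 2 * ∫ t in (0 : ℝ)..T, (‖u t‖ ^ 2 + ‖act C (x t) - z‖ ^ 2)

/-- `(u, x)` is an optimal pair for the problem on `[0,T]` with free endpoint (it exists, and `u` is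
unique up to null sets, by strict convexity). -/
def IsOptimalPair {n m p : ℕ} (A : Matrix (Fin n) (Fin n) ℝ) (B : Matrix (Fin n) (Fin m) ℝ)
    (C : Matrix (Fin p) (Fin n) ℝ) (x₀ : EuclideanSpace ℝ (Fin n)) (z : EuclideanSpace ℝ (Fin p))
    (T : ℝ) (u : ℝ → EuclideanSpace ℝ (Fin m)) (x : ℝ → EuclideanSpace ℝ (Fin n)) : Prop :=
  IsTrajectory A B x₀ T u x ∧
  ∀ v y, IsTrajectory A B x₀ T v y → cost C z T u x ≤ cost C z T v y

/-- The steady cost `½ (‖u‖² + ‖C x - z‖²)`. -/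
def steadyCost {n m p : ℕ} (C : Matrix (Fin p) (Fin n) ℝ) (z : EuclideanSpace ℝ (Fin p))
    (u : EuclideanSpace ℝ (Fin m)) (x : EuclideanSpace ℝ (Fin n)) : ℝ :=
  1 / 2 * (‖u‖ ^ 2 + ‖act C x - z‖ ^ 2)

/-- `(u, x)` minimizes the steady cost under the constraint `0 = A x + B u`. -/
def IsSteadyMinimizer {n m p : ℕ} (A : Matrix (Fin n) (Fin n) ℝ) (B : Matrix (Fin n) (Fin m) ℝ)
    (C : Matrix (Fin p) (Fin n) ℝ) (z : EuclideanSpace ℝ (Fin p))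
    (u : EuclideanSpace ℝ (Fin m)) (x : EuclideanSpace ℝ (Fin n)) : Prop :=
  act A x + act B u = 0 ∧
  ∀ v y, act A y + act B v = 0 → steadyCost C z u x ≤ steadyCost C z v y

/-! ### The detectable space and `C`-turnpike -/

/-- The unobservable space `⋂_{i < n} ker (C Aⁱ)`. -/
def unobservable {n p : ℕ} (A : Matrix (Fin n) (Fin n) ℝ) (C : Matrix (Fin p) (Fin n) ℝ) :
    Submodule ℝ (EuclideanSpace ℝ (Fin n)) :=
  ⨅ i : Fin n, LinearMap.ker (act (C * A ^ (i : ℕ)))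

/-- The inclusion `ℝⁿ → ℂⁿ`. -/
def complexify (n : ℕ) : EuclideanSpace ℝ (Fin n) →ₗ[ℝ] (Fin n → ℂ) where
  toFun x i := (x i : ℂ)
  map_add' x y := by ext i; simp
  map_smul' r x := by ext i; simp

/-- The real invariant subspace of `A` belonging to the eigenvalues with nonnegative real part:
the vectors of `ℝⁿ` which are sums of (complex) generalized eigenvectors of `A` for such
eigenvalues. -/
def unstableSpace {n : ℕ} (A : Matrix (Fin n) (Fin n) ℝ) :
    Submodule ℝ (EuclideanSpace ℝ (Fin n)) :=
  ((⨆ μ : {μ : ℂ // 0 ≤ μ.re},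
      Module.End.maxGenEigenspace (Matrix.toLin' (A.map Complex.ofReal)) (μ : ℂ)).restrictScalars
    ℝ).comap (complexify n)

/-- The undetectable space: the unobservable modes which are not stable. -/
def undetectable {n p : ℕ} (A : Matrix (Fin n) (Fin n) ℝ) (C : Matrix (Fin p) (Fin n) ℝ) :
    Submodule ℝ (EuclideanSpace ℝ (Fin n)) :=
  unobservable A C ⊓ unstableSpace A

/-- The orthogonal projection `D` onto the detectable space, the orthogonal complement of the
undetectable space. -/
def detectableProj {n p : ℕ} (A : Matrix (Fin n) (Fin n) ℝ) (C : Matrix (Fin p) (Fin n) ℝ) :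
    EuclideanSpace ℝ (Fin n) →L[ℝ] EuclideanSpace ℝ (Fin n) :=
  (undetectable A C)ᗮ.starProjection

/-- `(A, B, C)` enjoys `C`-turnpike. The rate `μ` depends on `A, B, C` only, the constant `K` on
`x₀` and `z` also. The control is an element of `L²(0,T)`, so the bound is for almost every `t`. -/
def CTurnpike {n m p : ℕ} (A : Matrix (Fin n) (Fin n) ℝ) (B : Matrix (Fin n) (Fin m) ℝ)
    (C : Matrix (Fin p) (Fin n) ℝ) : Prop :=
  ∃ μ : ℝ, 0 < μ ∧ ∀ (x₀ : EuclideanSpace ℝ (Fin n)) (z : EuclideanSpace ℝ (Fin p)),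
    ∃ K : ℝ, ∀ T : ℝ, 0 < T → ∀ u x, IsOptimalPair A B C x₀ z T u x →
      ∀ ubar xbar, IsSteadyMinimizer A B C z ubar xbar →
        ∀ᵐ t ∂(volume.restrict (Ioo 0 T)),
          ‖u t - ubar‖ + ‖detectableProj A C (x t) - detectableProj A C xbar‖ ≤
            K * (Real.exp (-μ * t) + Real.exp (-μ * (T - t)))

/-! ### The Galerkin projection of the pointwise controlled heat equation -/

/-- `A_N = diag(-λ₁, …, -λ_N)`. -/
def heatA (lam : ℕ → ℝ) (N : ℕ) : Matrix (Fin N) (Fin N) ℝ :=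
  Matrix.diagonal fun i => -lam i

/-- The column `B_N` of the values of the first `N` eigenfunctions at the control point. -/
def heatB {d : ℕ} (φ : ℕ → EuclideanSpace ℝ (Fin d) → ℝ) (xcon : EuclideanSpace ℝ (Fin d))
    (N : ℕ) : Matrix (Fin N) (Fin 1) ℝ :=
  fun i _ => φ i xcon

/-- The row `C_N` of the values of the first `N` eigenfunctions at the observation point. -/
def heatC {d : ℕ} (φ : ℕ → EuclideanSpace ℝ (Fin d) → ℝ) (xobs : EuclideanSpace ℝ (Fin d))
    (N : ℕ) : Matrix (Fin 1) (Fin N) ℝ :=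
  fun _ j => φ j xobs

end

end PointHeat

namespace PointHeat

/-! ### Scalar linear equations -/

/-! Since the spectrum is simple, the numbers `a i = -lam i` are distinct, and the claim becomes one
about a diagonal system with distinct `a i`, scalar control weights `b i` and scalar observation
weights `c i`.

Necessity. A mode with `c i ≠ 0`, `b i = 0`, `a i ≥ 0` evolves as `exp (a i * t)` under every
control, and `detectableProj` does not hide it. Starting from this mode with target 0, the optimal
state has size at least 1 in the middle of `(0, T)`, where the turnpike bound tends to 0.

Sufficiency. Optimal pairs are the solutions of the Pontryagin system with `x 0 = x₀`, `p T = 0`.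
The steady optimum solves the same system, so the difference solves the one with target 0. Its size
is measured by `wsq c x + wsq b p`, and two estimates carry the decay. Dissipation
(`exists_integral_power_le`): a storage function decreases at least at the rate `power`, so the
energy spent on an interval is bounded by the values at its ends. Observability
(`exists_wsq_le_integral_power`): the values at a time are bounded by the energy spent on a unit
interval around it, because exponentials with distinct rates are linearly independent. Together, the
energy on an inner interval is at most a constant times the energy on the two adjoining unit
intervals. Filling the hole gives a factor `θ < 1` for each unit removed at both ends, hence
exponential decay (`exists_wsq_le_exp`).

This controls the coordinates with `c i ≠ 0`. Those with `c i = 0`, `a i < 0` are stable and driven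
by a decaying control (`sq_le_exp_of_stable`); those with `c i = 0`, `a i ≥ 0` are removed by the
projection. -/

theorem sq_le_of_hasDerivAt_linear {a : ℝ} {f g : ℝ → ℝ} (hg : Continuous g)
    (hf : ∀ t, HasDerivAt f (a * f t + g t) t) {s t : ℝ} (hst : s ≤ t) :
    f t ^ 2 ≤ Real.exp ((2 * |a| + 1) * (t - s)) * (f s ^ 2 + ∫ r in s..t, g r ^ 2) := by
  -- Grönwall: `2|a|` absorbs the term `2 a f²`, and the extra 1 absorbs the `f²` in `2 f g ≤ f² +
  -- g²`.
  set k := 2 * |a| + 1 with hk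
  have hk0 : 0 ≤ k := by positivity
  have hd : ∀ r, HasDerivAt (fun r => Real.exp (-k * (r - s)) * f r ^ 2 - ∫ x in s..r, g x ^ 2)
      (Real.exp (-k * (r - s)) * (2 * f r * (a * f r + g r) - k * f r ^ 2) - g r ^ 2) r := by
    intro r
    have h1 : HasDerivAt (fun r => Real.exp (-k * (r - s))) (Real.exp (-k * (r - s)) * (-k)) r := by
      have := (((hasDerivAt_id r).sub_const s).const_mul (-k)).exp
      simpa using this
    have h2 : HasDerivAt (fun r => ∫ x in s..r, g x ^ 2) (g r ^ 2) r :=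
      intervalIntegral.integral_hasDerivAt_right ((hg.pow 2).intervalIntegrable _ _)
        (hg.pow 2).aestronglyMeasurable.stronglyMeasurableAtFilter (hg.pow 2).continuousAt
    have h3 := (h1.mul ((hf r).pow 2)).sub h2
    refine h3.congr_deriv ?_
    push_cast
    simp only [Pi.pow_apply, pow_one]
    ring
  have hanti : AntitoneOn (fun r => Real.exp (-k * (r - s)) * f r ^ 2 - ∫ x in s..r, g x ^ 2)
      (Ici s) := by
    refine antitoneOn_of_deriv_nonpos (convex_Ici s)
      (fun r _ => (hd r).continuousAt.continuousWithinAt)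
      (fun r _ => (hd r).differentiableAt.differentiableWithinAt) ?_
    intro r hr
    rw [interior_Ici, mem_Ioi] at hr
    rw [(hd r).deriv]
    have he : Real.exp (-k * (r - s)) ≤ 1 := by
      rw [Real.exp_le_one_iff]
      nlinarith [mul_nonneg hk0 (sub_nonneg.2 hr.le)]
    have he0 := Real.exp_pos (-k * (r - s))
    have h4 : 2 * f r * (a * f r + g r) - k * f r ^ 2 ≤ g r ^ 2 := by
      have : a * f r ^ 2 ≤ |a| * f r ^ 2 :=
        mul_le_mul_of_nonneg_right (le_abs_self a) (sq_nonneg _)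
      rw [hk]
      nlinarith [sq_nonneg (f r - g r)]
    nlinarith [mul_le_mul_of_nonneg_left h4 he0.le,
      mul_le_mul_of_nonneg_right he (sq_nonneg (g r))]
  have h := hanti (mem_Ici.2 le_rfl) (mem_Ici.2 hst) hst
  simp only [sub_self, mul_zero, Real.exp_zero, one_mul, intervalIntegral.integral_same,
    sub_zero] at h
  have h5 : Real.exp (-k * (t - s)) * f t ^ 2 ≤ f s ^ 2 + ∫ x in s..t, g x ^ 2 := by linarith
  calc f t ^ 2 = Real.exp (k * (t - s)) * (Real.exp (-k * (t - s)) * f t ^ 2) := by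
        rw [← mul_assoc, ← Real.exp_add]; simp
    _ ≤ _ := by gcongr

theorem sq_le_of_hasDerivAt_linear_backward {a : ℝ} {f g : ℝ → ℝ} (hg : Continuous g)
    (hf : ∀ t, HasDerivAt f (a * f t + g t) t) {s t : ℝ} (hst : s ≤ t) :
    f s ^ 2 ≤ Real.exp ((2 * |a| + 1) * (t - s)) * (f t ^ 2 + ∫ r in s..t, g r ^ 2) := by
  have h := sq_le_of_hasDerivAt_linear (a := -a) (f := fun r => f (-r)) (g := fun r => -g (-r))
    (by fun_prop) (fun r => by
      have := (hf (-r)).comp r (hasDerivAt_neg r)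
      refine this.congr_deriv ?_
      ring) (neg_le_neg hst)
  simpa [intervalIntegral.integral_comp_neg (fun r => g r ^ 2), abs_neg, neg_add_eq_sub] using h

theorem eq_exp_mul_of_hasDerivAt {a : ℝ} {f : ℝ → ℝ}
    (hf : ∀ t, HasDerivAt f (a * f t) t) (t : ℝ) : f t = Real.exp (a * t) * f 0 := by
  have hd : ∀ r, HasDerivAt (fun r => Real.exp (-a * r) * f r) 0 r := by
    intro r
    have h1 : HasDerivAt (fun r => Real.exp (-a * r)) (Real.exp (-a * r) * (-a)) r := by
      simpa using ((hasDerivAt_id r).const_mul (-a)).exp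
    exact (h1.mul (hf r)).congr_deriv (by ring)
  have h := is_const_of_deriv_eq_zero (fun r => (hd r).differentiableAt) (fun r => (hd r).deriv) t 0
  simp only [mul_zero, Real.exp_zero, one_mul] at h
  rw [← h, ← mul_assoc, ← Real.exp_add]
  simp

/-! ### Observability -/

/-- The right side is a quadratic form in `d`, positive off 0 by linear independence of the
exponentials; its minimum on the compact unit sphere gives the constant. -/
theorem exists_sum_sq_le_integral_exp_sq {n : ℕ} {a : Fin n → ℝ} (ha : Function.Injective a) :
    ∃ k : ℝ, 0 < k ∧ ∀ d : Fin n → ℝ,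
      ∑ i, d i ^ 2 ≤ k * ∫ r in (0 : ℝ)..1, (∑ i, d i * Real.exp (a i * r)) ^ 2 := by
  set Q : EuclideanSpace ℝ (Fin n) → ℝ :=
    fun d => ∫ r in (0 : ℝ)..1, (∑ i, d i * Real.exp (a i * r)) ^ 2 with hQ
  have hcont : Continuous Q := by
    apply intervalIntegral.continuous_parametric_intervalIntegral_of_continuous'
    simp only [Function.uncurry_def]
    fun_prop
  have hsc : ∀ (r : ℝ) d, Q (r • d) = r ^ 2 * Q d := by
    intro r d
    simp only [hQ]
    rw [← intervalIntegral.integral_const_mul]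
    congr 1
    ext t
    rw [← mul_pow, Finset.mul_sum]
    simp [mul_assoc]
  have hpos : ∀ d ∈ Metric.sphere (0 : EuclideanSpace ℝ (Fin n)) 1, 0 < Q d := by
    intro d hd
    have hc : Continuous fun r : ℝ => (∑ i, d i * Real.exp (a i * r)) ^ 2 := by fun_prop
    have h0 : 0 ≤ Q d :=
      intervalIntegral.integral_nonneg zero_le_one (fun _ _ => sq_nonneg _)
    refine h0.lt_of_ne fun h => ?_
    have hz : ∀ r ∈ Icc (0 : ℝ) 1, ∑ i, d i * Real.exp (a i * r) = 0 := by
      intro r hr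
      by_contra hne
      have := intervalIntegral.integral_pos (a := (0 : ℝ)) (b := 1) zero_lt_one hc.continuousOn
        (fun _ _ => sq_nonneg _) ⟨r, hr, by positivity⟩
      exact absurd h this.ne
    have hd0 : (fun i => d i) = 0 := by
      rcases Nat.eq_zero_or_pos n with rfl | hn
      · exact Subsingleton.elim _ _
      have hn' : (0 : ℝ) < n := by exact_mod_cast hn
      -- Sampling at the times `k / n` gives a Vandermonde system with the distinct nodes `exp (a i
      -- / n)`.
      refine Matrix.eq_zero_of_forall_pow_sum_mul_pow_eq_zero
        (f := fun i => Real.exp (a i / n)) ?_ ?_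
      · intro i j hij
        have := Real.exp_injective hij
        field_simp at this
        exact ha this
      · intro k
        rw [← hz (k / n) ⟨by positivity, by
          rw [div_le_one hn']; exact_mod_cast k.2.le⟩]
        refine Finset.sum_congr rfl fun j _ => ?_
        rw [← Real.exp_nat_mul]
        congr 2
        ring
    have : d = 0 := by ext i; exact congrFun hd0 i
    simp [this] at hd
  obtain ⟨κ, hκ, hmin⟩ := (isCompact_sphere (0 : EuclideanSpace ℝ (Fin n)) 1).exists_forall_le'
    hcont.continuousOn hpos
  refine ⟨κ⁻¹, inv_pos.2 hκ, fun d => ?_⟩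
  set e : EuclideanSpace ℝ (Fin n) := WithLp.toLp 2 d
  have hn : ∑ i, d i ^ 2 = ‖e‖ ^ 2 := by
    rw [EuclideanSpace.real_norm_sq_eq]
  change _ ≤ κ⁻¹ * Q e
  rw [hn, le_inv_mul_iff₀ hκ]
  by_cases he : e = 0
  · rw [he, norm_zero]
    have := hsc 0 0
    simp only [zero_smul] at this
    rw [this]
    simp
  · have hne : ‖e‖ ≠ 0 := norm_ne_zero_iff.2 he
    have h1 := hmin (‖e‖⁻¹ • e) (by simp [norm_smul, hne])
    rw [hsc, inv_pow, le_inv_mul_iff₀ (by positivity)] at h1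
    linarith

/-- Without input this is the Gram bound for exponentials. The input `g` perturbs the free evolution
by an amount controlled by its `L²` norm on the unit interval. The lemma serves both the state and,
with `-a` and the roles of `b` and `c` exchanged, the adjoint. -/
theorem exists_observability {n : ℕ} {a : Fin n → ℝ} (ha : Function.Injective a)
    (c d : Fin n → ℝ) :
    ∃ k : ℝ, 0 < k ∧ ∀ (f : ℝ → Fin n → ℝ) (g : ℝ → ℝ), Continuous g →
      (∀ i t, HasDerivAt (fun t => f t i) (a i * f t i + d i * g t) t) → ∀ s : ℝ,
      ∑ i, (c i * f s i) ^ 2 ≤ k * ∫ r in s..s + 1, ((∑ i, c i * f r i) ^ 2 + g r ^ 2) := by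
  obtain ⟨k, hk, hgram⟩ := exists_sum_sq_le_integral_exp_sq ha
  set L : ℝ := ∑ i, (c i) ^ 2 * (Real.exp (2 * |a i| + 1) * (d i) ^ 2) with hL
  have hL0 : 0 ≤ L := Finset.sum_nonneg fun i _ => by positivity
  refine ⟨k * (2 + 2 * n * L), by positivity, fun f g hg hf s => ?_⟩
  have hfc : ∀ i, Continuous fun t => f t i := fun i =>
    continuous_iff_continuousAt.2 fun t => (hf i t).continuousAt
  set G := ∫ r in s..s + 1, g r ^ 2 with hG
  have hG0 : 0 ≤ G := intervalIntegral.integral_nonneg (by linarith) (fun _ _ => sq_nonneg _)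
  -- Deviation from the free evolution: it starts at 0 and solves the same equation, driven by the
  -- input only.
  have hh : ∀ i, ∀ r ∈ Icc (0 : ℝ) 1,
      (f (s + r) i - Real.exp (a i * r) * f s i) ^ 2 ≤
        Real.exp (2 * |a i| + 1) * (d i) ^ 2 * G := by
    intro i r hr
    have h := sq_le_of_hasDerivAt_linear (a := a i)
      (f := fun r => f (s + r) i - Real.exp (a i * r) * f s i) (g := fun r => d i * g (s + r))
      (by fun_prop) (fun t => by
        have h1 : HasDerivAt (fun r => f (s + r) i)
            (a i * f (s + t) i + d i * g (s + t)) t := by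
          simpa using HasDerivAt.comp_const_add s t (hf i (s + t))
        have h2 : HasDerivAt (fun r => Real.exp (a i * r) * f s i)
            (Real.exp (a i * t) * a i * f s i) t := by
          have := ((hasDerivAt_id t).const_mul (a i)).exp
          simpa using this.mul_const (f s i)
        exact (h1.sub h2).congr_deriv (by ring)) hr.1
    simp only [add_zero, mul_zero, Real.exp_zero, one_mul, sub_self, sub_zero, ne_eq,
      OfNat.ofNat_ne_zero, not_false_eq_true, zero_pow, zero_add] at h
    refine h.trans ?_
    have h3 : ∫ x in (0 : ℝ)..r, (d i * g (s + x)) ^ 2 ≤ (d i) ^ 2 * G := by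
      have hc : Continuous fun x => (d i * g (s + x)) ^ 2 := by fun_prop
      calc ∫ x in (0 : ℝ)..r, (d i * g (s + x)) ^ 2
          ≤ ∫ x in (0 : ℝ)..1, (d i * g (s + x)) ^ 2 :=
            intervalIntegral.integral_mono_interval le_rfl hr.1 hr.2
              (Filter.Eventually.of_forall fun _ => sq_nonneg _) (hc.intervalIntegrable _ _)
        _ = (d i) ^ 2 * G := by
            simp only [mul_pow]
            rw [intervalIntegral.integral_const_mul,
              intervalIntegral.integral_comp_add_left (fun x => g x ^ 2), add_zero]
    have h4 : Real.exp ((2 * |a i| + 1) * r) ≤ Real.exp (2 * |a i| + 1) :=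
      Real.exp_le_exp.2 (mul_le_of_le_one_right (by positivity) hr.2)
    rw [mul_assoc]
    have h5 : 0 ≤ ∫ x in (0 : ℝ)..r, (d i * g (s + x)) ^ 2 :=
      intervalIntegral.integral_nonneg hr.1 (fun _ _ => sq_nonneg _)
    gcongr
  have hpt : ∀ r ∈ Icc (0 : ℝ) 1, (∑ i, (c i * f s i) * Real.exp (a i * r)) ^ 2 ≤
      2 * (∑ i, c i * f (s + r) i) ^ 2 + 2 * n * L * G := by
    intro r hr
    have h1 : ∑ i, (c i * f s i) * Real.exp (a i * r) = ∑ i, c i * f (s + r) i -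
        ∑ i, c i * (f (s + r) i - Real.exp (a i * r) * f s i) := by
      rw [← Finset.sum_sub_distrib]
      exact Finset.sum_congr rfl fun i _ => by ring
    have h2 : (∑ i, c i * (f (s + r) i - Real.exp (a i * r) * f s i)) ^ 2 ≤ n * (L * G) := by
      refine (sq_sum_le_card_mul_sum_sq).trans ?_
      rw [Finset.card_univ, Fintype.card_fin, hL, Finset.sum_mul]
      gcongr with i _
      rw [mul_pow, mul_assoc]
      gcongr
      exact hh i r hr
    rw [h1]
    nlinarith [sq_nonneg (∑ i, c i * f (s + r) i +
        ∑ i, c i * (f (s + r) i - Real.exp (a i * r) * f s i))]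
  have hy : Continuous fun r => (∑ i, c i * f r i) ^ 2 := by fun_prop
  have hY0 : 0 ≤ ∫ r in s..s + 1, (∑ i, c i * f r i) ^ 2 :=
    intervalIntegral.integral_nonneg (by linarith) (fun _ _ => sq_nonneg _)
  calc ∑ i, (c i * f s i) ^ 2
      ≤ k * ∫ r in (0 : ℝ)..1, (∑ i, (c i * f s i) * Real.exp (a i * r)) ^ 2 := hgram _
    _ ≤ k * ∫ r in (0 : ℝ)..1, (2 * (∑ i, c i * f (s + r) i) ^ 2 + 2 * n * L * G) := by
        gcongr
        refine intervalIntegral.integral_mono_on zero_le_one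
          (Continuous.intervalIntegrable (by fun_prop) _ _)
          (Continuous.intervalIntegrable (by fun_prop) _ _) hpt
    _ = k * (2 * (∫ r in s..s + 1, (∑ i, c i * f r i) ^ 2) + 2 * n * L * G) := by
        rw [intervalIntegral.integral_add (Continuous.intervalIntegrable (by fun_prop) _ _)
          (by simp), intervalIntegral.integral_const_mul,
          intervalIntegral.integral_comp_add_left (fun x => (∑ i, c i * f x i) ^ 2)]
        simp
    _ ≤ k * (2 + 2 * n * L) * ∫ r in s..s + 1, ((∑ i, c i * f r i) ^ 2 + g r ^ 2) := by
        rw [intervalIntegral.integral_add (hy.intervalIntegrable _ _)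
          (Continuous.intervalIntegrable (by fun_prop) _ _), mul_assoc k]
        refine mul_le_mul_of_nonneg_left ?_ hk.le
        have : 0 ≤ 2 * n * L := by positivity
        nlinarith [mul_nonneg this hY0]

/-! ### The Hamiltonian system -/

/-- The weighted sum of squares `∑ (wᵢ fᵢ)²`. -/
def wsq {n : ℕ} (w f : Fin n → ℝ) : ℝ := ∑ i, (w i * f i) ^ 2

theorem wsq_nonneg {n : ℕ} (w f : Fin n → ℝ) : 0 ≤ wsq w f :=
  Finset.sum_nonneg fun _ _ => sq_nonneg _

theorem sq_le_wsq {n : ℕ} (w f : Fin n → ℝ) (i : Fin n) : (w i * f i) ^ 2 ≤ wsq w f :=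
  Finset.single_le_sum (f := fun i => (w i * f i) ^ 2) (fun _ _ => sq_nonneg _) (Finset.mem_univ i)

theorem abs_le_sqrt_wsq {n : ℕ} (w f : Fin n → ℝ) (i : Fin n) : |w i * f i| ≤ √(wsq w f) :=
  Real.abs_le_sqrt (sq_le_wsq w f i)

theorem sum_sq_le_wsq {n : ℕ} (w f : Fin n → ℝ) : (∑ i, w i * f i) ^ 2 ≤ n * wsq w f := by
  refine (sq_sum_le_card_mul_sum_sq).trans ?_
  rw [Finset.card_univ, Fintype.card_fin, wsq]

theorem exists_wsq_le {n : ℕ} (a d w : Fin n → ℝ) :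
    ∃ E : ℝ, 0 < E ∧ ∀ (f : ℝ → Fin n → ℝ) (g : ℝ → ℝ), Continuous g →
      (∀ i t, HasDerivAt (fun t => f t i) (a i * f t i + d i * g t) t) → ∀ s t : ℝ,
      s ≤ t → t ≤ s + 1 →
      wsq w (f t) ≤ E * (wsq w (f s) + ∫ r in s..t, g r ^ 2) ∧
      wsq w (f s) ≤ E * (wsq w (f t) + ∫ r in s..t, g r ^ 2) := by
  refine ⟨∑ i, Real.exp (2 * |a i| + 1) * (1 + (w i * d i) ^ 2) + 1,
    add_pos_of_nonneg_of_pos (Finset.sum_nonneg fun i _ => by positivity) one_pos,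
    fun f g hg hf s t hst hts => ?_⟩
  have hG : 0 ≤ ∫ r in s..t, g r ^ 2 :=
    intervalIntegral.integral_nonneg hst (fun _ _ => sq_nonneg _)
  have hint : ∀ i, ∫ r in s..t, (d i * g r) ^ 2 = d i ^ 2 * ∫ r in s..t, g r ^ 2 := by
    intro i
    simp only [mul_pow]
    rw [intervalIntegral.integral_const_mul]
  have hexp : ∀ i, Real.exp ((2 * |a i| + 1) * (t - s)) ≤ Real.exp (2 * |a i| + 1) := fun i =>
    Real.exp_le_exp.2 (mul_le_of_le_one_right (by positivity) (by linarith))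
  have key : ∀ (p q : Fin n → ℝ), (∀ i, p i ^ 2 ≤ Real.exp ((2 * |a i| + 1) * (t - s)) *
      (q i ^ 2 + ∫ r in s..t, (d i * g r) ^ 2)) → wsq w p ≤
      (∑ i, Real.exp (2 * |a i| + 1) * (1 + (w i * d i) ^ 2) + 1) *
        (wsq w q + ∫ r in s..t, g r ^ 2) := by
    intro p q hpq
    have hS : 0 ≤ wsq w q + ∫ r in s..t, g r ^ 2 := add_nonneg (wsq_nonneg _ _) hG
    calc wsq w p ≤ ∑ i, Real.exp (2 * |a i| + 1) * (1 + (w i * d i) ^ 2) *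
          (wsq w q + ∫ r in s..t, g r ^ 2) := by
          refine Finset.sum_le_sum fun i _ => ?_
          have h1 := hpq i
          rw [hint] at h1
          have h2 : 0 ≤ q i ^ 2 + d i ^ 2 * ∫ r in s..t, g r ^ 2 := by positivity
          calc (w i * p i) ^ 2 = w i ^ 2 * p i ^ 2 := mul_pow _ _ _
            _ ≤ w i ^ 2 * (Real.exp (2 * |a i| + 1) *
                (q i ^ 2 + d i ^ 2 * ∫ r in s..t, g r ^ 2)) := by
                gcongr
                exact h1.trans (mul_le_mul_of_nonneg_right (hexp i) h2)
            _ = Real.exp (2 * |a i| + 1) * ((w i * q i) ^ 2 +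
                (w i * d i) ^ 2 * ∫ r in s..t, g r ^ 2) := by ring
            _ ≤ _ := by
                rw [mul_assoc]
                gcongr
                nlinarith [sq_le_wsq w q i, wsq_nonneg w q,
                  mul_nonneg (sq_nonneg (w i * d i)) (wsq_nonneg w q)]
      _ ≤ _ := by
          rw [← Finset.sum_mul]
          gcongr
          linarith
  exact ⟨key _ _ fun i => sq_le_of_hasDerivAt_linear (by fun_prop) (hf i) hst,
    key _ _ fun i => sq_le_of_hasDerivAt_linear_backward (by fun_prop) (hf i) hst⟩

/-- The optimality system of the linear quadratic problem with diagonal dynamics `a`, scalar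
control operator `b`, scalar observation `c` and target `z`; the control is `-∑ bⱼ pⱼ`. -/
structure IsHamiltonian {n : ℕ} (a b c : Fin n → ℝ) (z : ℝ) (x p : ℝ → Fin n → ℝ) : Prop where
  state : ∀ i t, HasDerivAt (fun t => x t i) (a i * x t i - b i * ∑ j, b j * p t j) t
  adjoint : ∀ i t, HasDerivAt (fun t => p t i) (-a i * p t i - c i * (∑ j, c j * x t j - z)) t

/-- The power `|u|² + |y|²` of control and observation. -/
def power {n : ℕ} (b c : Fin n → ℝ) (x p : ℝ → Fin n → ℝ) (t : ℝ) : ℝ :=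
  (∑ j, c j * x t j) ^ 2 + (∑ j, b j * p t j) ^ 2

namespace IsHamiltonian

variable {n : ℕ} {a b c : Fin n → ℝ} {z : ℝ} {x p : ℝ → Fin n → ℝ}

theorem continuous_state (h : IsHamiltonian a b c z x p) (i : Fin n) : Continuous fun t => x t i :=
  continuous_iff_continuousAt.2 fun t => (h.state i t).continuousAt

theorem continuous_adjoint (h : IsHamiltonian a b c z x p) (i : Fin n) :
    Continuous fun t => p t i :=
  continuous_iff_continuousAt.2 fun t => (h.adjoint i t).continuousAt

theorem continuous_input (h : IsHamiltonian a b c z x p) : Continuous fun t => ∑ j, b j * p t j := by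
  have := h.continuous_adjoint
  fun_prop

theorem continuous_output (h : IsHamiltonian a b c z x p) :
    Continuous fun t => ∑ j, c j * x t j := by
  have := h.continuous_state
  fun_prop

theorem continuous_power (h : IsHamiltonian a b c z x p) : Continuous (power b c x p) :=
  (h.continuous_output.pow 2).add (h.continuous_input.pow 2)

theorem intervalIntegrable_power (h : IsHamiltonian a b c z x p) (s t : ℝ) :
    IntervalIntegrable (power b c x p) volume s t :=
  h.continuous_power.intervalIntegrable s t

end IsHamiltonian

theorem power_nonneg {n : ℕ} (b c : Fin n → ℝ) (x p : ℝ → Fin n → ℝ) (t : ℝ) :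
    0 ≤ power b c x p t := by unfold power; positivity

theorem integral_power_nonneg {n : ℕ} (b c : Fin n → ℝ) (x p : ℝ → Fin n → ℝ) {s t : ℝ}
    (h : s ≤ t) : 0 ≤ ∫ r in s..t, power b c x p r :=
  intervalIntegral.integral_nonneg h fun _ _ => power_nonneg _ _ _ _ _

theorem IsHamiltonian.integral_power_mono {n : ℕ} {a b c : Fin n → ℝ} {z : ℝ} {x p : ℝ → Fin n → ℝ}
    (h : IsHamiltonian a b c z x p) {s t s' t' : ℝ} (h1 : s ≤ s') (h2 : s' ≤ t') (h3 : t' ≤ t) :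
    ∫ r in s'..t', power b c x p r ≤ ∫ r in s..t, power b c x p r :=
  intervalIntegral.integral_mono_interval h1 h2 h3
    (Filter.Eventually.of_forall fun _ => power_nonneg _ _ _ _ _) (h.intervalIntegrable_power _ _)

theorem exists_wsq_le_hamiltonian {n : ℕ} (a b c : Fin n → ℝ) :
    ∃ E : ℝ, 0 < E ∧ ∀ x p, IsHamiltonian a b c 0 x p → ∀ s t : ℝ, s ≤ t → t ≤ s + 1 →
      wsq c (x t) ≤ E * (wsq c (x s) + ∫ r in s..t, power b c x p r) ∧
      wsq b (p t) ≤ E * (wsq b (p s) + ∫ r in s..t, power b c x p r) ∧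
      wsq b (p s) ≤ E * (wsq b (p t) + ∫ r in s..t, power b c x p r) := by
  obtain ⟨E₁, hE₁, h₁⟩ := exists_wsq_le a (-b) c
  obtain ⟨E₂, hE₂, h₂⟩ := exists_wsq_le (-a) (-c) b
  refine ⟨E₁ + E₂, by positivity, fun x p h s t hst hts => ?_⟩
  have hx := h₁ x _ h.continuous_input (fun i t => (h.state i t).congr_deriv (by simp; ring))
    s t hst hts
  have hp := h₂ p _ h.continuous_output (fun i t => (h.adjoint i t).congr_deriv (by simp; ring))
    s t hst hts
  have hi : ∫ r in s..t, (∑ j, b j * p r j) ^ 2 ≤ ∫ r in s..t, power b c x p r :=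
    intervalIntegral.integral_mono_on hst ((h.continuous_input.pow 2).intervalIntegrable _ _)
      (h.intervalIntegrable_power _ _) fun r _ => le_add_of_nonneg_left (sq_nonneg _)
  have ho : ∫ r in s..t, (∑ j, c j * x r j) ^ 2 ≤ ∫ r in s..t, power b c x p r :=
    intervalIntegral.integral_mono_on hst ((h.continuous_output.pow 2).intervalIntegrable _ _)
      (h.intervalIntegrable_power _ _) fun r _ => le_add_of_nonneg_right (sq_nonneg _)
  have hP := integral_power_nonneg b c x p hst
  have e1 := wsq_nonneg c (x s)
  have e2 := wsq_nonneg b (p s)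
  have e3 := wsq_nonneg b (p t)
  have hi0 : 0 ≤ ∫ r in s..t, (∑ j, b j * p r j) ^ 2 :=
    intervalIntegral.integral_nonneg hst fun _ _ => sq_nonneg _
  have ho0 : 0 ≤ ∫ r in s..t, (∑ j, c j * x r j) ^ 2 :=
    intervalIntegral.integral_nonneg hst fun _ _ => sq_nonneg _
  exact ⟨hx.1.trans (mul_le_mul (by linarith) (by linarith) (by linarith) (by linarith)),
    hp.1.trans (mul_le_mul (by linarith) (by linarith) (by linarith) (by linarith)),
    hp.2.trans (mul_le_mul (by linarith) (by linarith) (by linarith) (by linarith))⟩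

theorem exists_wsq_le_integral_power {n : ℕ} {a : Fin n → ℝ} (ha : Function.Injective a)
    (b c : Fin n → ℝ) :
    ∃ k : ℝ, 0 < k ∧ ∀ x p, IsHamiltonian a b c 0 x p → ∀ s t : ℝ, s ≤ t → t ≤ s + 1 →
      wsq c (x t) + wsq b (p t) ≤ k * ∫ r in s..s + 1, power b c x p r := by
  obtain ⟨k₁, hk₁, h₁⟩ := exists_observability ha c (-b)
  obtain ⟨k₂, hk₂, h₂⟩ := exists_observability (neg_injective.comp ha) b (-c)
  obtain ⟨E, hE, h₃⟩ := exists_wsq_le_hamiltonian a b c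
  refine ⟨E * (k₁ + k₂ + 2), by positivity, fun x p h s t hst hts => ?_⟩
  have hx := h₁ x _ h.continuous_input (fun i t => (h.state i t).congr_deriv (by simp; ring)) s
  have hp := h₂ p _ h.continuous_output (fun i t => (h.adjoint i t).congr_deriv (by simp; ring)) s
  have hp' : ∫ r in s..s + 1, ((∑ j, b j * p r j) ^ 2 + (∑ j, c j * x r j) ^ 2) =
      ∫ r in s..s + 1, power b c x p r := by
    congr 1; ext r; rw [add_comm]; rfl
  rw [hp'] at hp
  change wsq c (x s) ≤ k₁ * ∫ r in s..s + 1, power b c x p r at hx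
  change wsq b (p s) ≤ _ at hp
  obtain ⟨e1, e2, -⟩ := h₃ x p h s t hst hts
  have hm := h.integral_power_mono le_rfl hst hts
  calc wsq c (x t) + wsq b (p t) ≤ E * (wsq c (x s) + ∫ r in s..t, power b c x p r) +
        E * (wsq b (p s) + ∫ r in s..t, power b c x p r) := add_le_add e1 e2
    _ ≤ E * (k₁ * (∫ r in s..s + 1, power b c x p r) + ∫ r in s..s + 1, power b c x p r) +
        E * (k₂ * (∫ r in s..s + 1, power b c x p r) + ∫ r in s..s + 1, power b c x p r) := by
        gcongr
    _ = _ := by ring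

/-! ### Dissipativity -/

/-- A storage function: its derivative along the Hamiltonian flow is at most minus the power. -/
noncomputable def storage {n : ℕ} (a b c : Fin n → ℝ) (x p : Fin n → ℝ) : ℝ :=
  ∑ i, if b i = 0 then -(n / a i) * (c i * x i) ^ 2 else 2 * (x i * p i)

theorem hasDerivAt_storage {n : ℕ} {a b c : Fin n → ℝ}
    {x p : ℝ → Fin n → ℝ} (h : IsHamiltonian a b c 0 x p) (t : ℝ) :
    HasDerivAt (fun t => storage a b c (x t) (p t))
      (∑ i, if b i = 0 then -(n / a i) * (2 * a i * (c i * x t i) ^ 2) else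
        -2 * (b i * p t i) * (∑ j, b j * p t j) - 2 * (c i * x t i) * ∑ j, c j * x t j) t := by
  unfold storage
  refine HasDerivAt.fun_sum fun i _ => ?_
  by_cases hb : b i = 0
  · simp only [hb, if_true]
    have := (((h.state i t).const_mul (c i)).pow 2).const_mul (-(n / a i))
    refine this.congr_deriv ?_
    simp only [hb]
    push_cast
    simp only [pow_one]
    ring
  · simp only [hb, if_false]
    refine (((h.state i t).mul (h.adjoint i t)).const_mul 2).congr_deriv ?_
    ring

/-- Along the flow, the sum of all `2 * x i * p i` would have derivative `-2 * power`. Where `b i =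
0`, however, `wsq b p` says nothing about `p i`, so `storage` uses a multiple of `(c i * x i) ^ 2`
there, which decays because `a i < 0`. The factor `n` pays, via Cauchy–Schwarz, for the cross terms
lost in this exchange. -/
theorem storage_dissipation {n : ℕ} {a b c : Fin n → ℝ}
    (hP : ∀ i, c i ≠ 0 → b i ≠ 0 ∨ a i < 0) (x p : Fin n → ℝ) :
    (∑ i, if b i = 0 then -(n / a i) * (2 * a i * (c i * x i) ^ 2) else
        -2 * (b i * p i) * (∑ j, b j * p j) - 2 * (c i * x i) * ∑ j, c j * x j) ≤
      -((∑ j, c j * x j) ^ 2 + (∑ j, b j * p j) ^ 2) := by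
  set β := ∑ j, b j * p j
  set y := ∑ j, c j * x j
  -- `∑ e i` is the part of the output coming from the uncontrolled modes, i.e. what `∑ c j * x j`
  -- loses when those products are replaced.
  set e : Fin n → ℝ := fun i => if b i = 0 then c i * x i else 0 with he
  have h1 : ∀ i, (if b i = 0 then -(n / a i) * (2 * a i * (c i * x i) ^ 2) else
        -2 * (b i * p i) * β - 2 * (c i * x i) * y) =
      -2 * n * e i ^ 2 - 2 * (b i * p i) * β - 2 * (c i * x i) * y + 2 * e i * y := by
    intro i
    by_cases hb : b i = 0
    · simp only [hb, if_true, he]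
      by_cases hc : c i = 0
      · simp [hc]
      · have ha : a i ≠ 0 := ((hP i hc).resolve_left (not_not.2 hb)).ne
        field_simp
        ring
    · simp only [hb, if_false, he]
      ring
  have hs : (∑ i, e i) ^ 2 ≤ n * ∑ i, e i ^ 2 := by
    refine (sq_sum_le_card_mul_sum_sq).trans ?_
    rw [Finset.card_univ, Fintype.card_fin]
  have h2 : (∑ i, (-2 * n * e i ^ 2 - 2 * (b i * p i) * β - 2 * (c i * x i) * y + 2 * e i * y)) =
      -2 * (n * ∑ i, e i ^ 2) - 2 * β * β - 2 * y * y + 2 * (∑ i, e i) * y := by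
    simp only [Finset.sum_add_distrib, Finset.sum_sub_distrib, ← Finset.mul_sum, ← Finset.sum_mul]
    ring
  rw [Finset.sum_congr rfl fun i _ => h1 i, h2]
  nlinarith [sq_nonneg (∑ i, e i - y), sq_nonneg β, sq_nonneg (∑ i, e i)]

/-- Integrate the dissipation inequality and bound `storage` at both ends. The products `x i * p i`
are controlled by the weighted norms if `b i * c i ≠ 0`; if `c i = 0` they vanish, which is why the
adjoint is required to be zero on unobserved modes. -/
theorem exists_integral_power_le {n : ℕ} {a b c : Fin n → ℝ}
    (hP : ∀ i, c i ≠ 0 → b i ≠ 0 ∨ a i < 0) :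
    ∃ Λ : ℝ, 0 < Λ ∧ ∀ x p, IsHamiltonian a b c 0 x p → (∀ i t, c i = 0 → p t i = 0) →
      ∀ s t : ℝ, s ≤ t → ∫ r in s..t, power b c x p r ≤
        Λ * (√(wsq c (x s)) * √(wsq b (p s)) + wsq c (x s) +
          √(wsq c (x t)) * √(wsq b (p t))) := by
  set l : Fin n → ℝ := fun i => 2 * |(c i * b i)⁻¹| + |n / a i| with hl
  have hl0 : ∀ i, 0 ≤ l i := fun i => by positivity
  refine ⟨∑ i, l i + 1, add_pos_of_nonneg_of_pos (Finset.sum_nonneg fun i _ => hl0 i) one_pos,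
    fun x p h hp s t hst => ?_⟩
  have hmul : ∀ r i, b i ≠ 0 →
      |2 * (x r i * p r i)| ≤ l i * (√(wsq c (x r)) * √(wsq b (p r))) := by
    intro r i hb
    by_cases hc : c i = 0
    · simp only [hp i r hc, mul_zero, abs_zero]
      have := hl0 i
      positivity
    · have e : 2 * (x r i * p r i) = 2 * (c i * b i)⁻¹ * ((c i * x r i) * (b i * p r i)) := by
        field_simp
      rw [e, abs_mul, abs_mul, abs_mul, abs_two]
      have h1 := abs_le_sqrt_wsq c (x r) i
      have h2 := abs_le_sqrt_wsq b (p r) i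
      have h3 : 2 * |(c i * b i)⁻¹| ≤ l i := by simp [hl]
      have := hl0 i
      gcongr
  have hup : ∀ r, storage a b c (x r) (p r) ≤
      (∑ i, l i) * (√(wsq c (x r)) * √(wsq b (p r)) + wsq c (x r)) := by
    intro r
    rw [Finset.sum_mul]
    refine Finset.sum_le_sum fun i _ => ?_
    have hW := wsq_nonneg c (x r)
    have hS : 0 ≤ √(wsq c (x r)) * √(wsq b (p r)) := by positivity
    split_ifs with hb
    · have h1 := sq_le_wsq c (x r) i
      have h2 : -(n / a i) ≤ l i := (neg_le_abs _).trans (le_add_of_nonneg_left (by positivity))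
      calc -(n / a i) * (c i * x r i) ^ 2 ≤ l i * (c i * x r i) ^ 2 := by gcongr
        _ ≤ l i * (√(wsq c (x r)) * √(wsq b (p r)) + wsq c (x r)) := by
          have := hl0 i
          gcongr
          linarith
    · refine (le_abs_self _).trans ((hmul r i hb).trans ?_)
      have := hl0 i
      gcongr
      linarith
  have hlow : ∀ r, -storage a b c (x r) (p r) ≤
      (∑ i, l i) * (√(wsq c (x r)) * √(wsq b (p r))) := by
    intro r
    rw [Finset.sum_mul, storage, ← Finset.sum_neg_distrib]
    refine Finset.sum_le_sum fun i _ => ?_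
    have hS : 0 ≤ √(wsq c (x r)) * √(wsq b (p r)) := by positivity
    split_ifs with hb
    -- The uncontrolled terms of `storage` are nonnegative, so they are dropped at the right end: no
    -- `wsq c (x t)` appears alone there.
    · refine le_trans ?_ (mul_nonneg (hl0 i) hS)
      by_cases hc : c i = 0
      · simp [hc]
      · have ha := (hP i hc).resolve_left (not_not.2 hb)
        have h3 : (n : ℝ) / a i ≤ 0 := div_nonpos_of_nonneg_of_nonpos (by positivity) ha.le
        nlinarith [mul_nonneg (neg_nonneg.2 h3) (sq_nonneg (c i * x r i))]
    · exact (neg_le_abs _).trans (hmul r i hb)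
  have hanti : AntitoneOn (fun r => storage a b c (x r) (p r) + ∫ q in s..r, power b c x p q)
      (Icc s t) := by
    have hd : ∀ r, HasDerivAt (fun r => storage a b c (x r) (p r) + ∫ q in s..r, power b c x p q)
        _ r := fun r => (hasDerivAt_storage h r).add
      (intervalIntegral.integral_hasDerivAt_right (h.intervalIntegrable_power _ _)
        h.continuous_power.aestronglyMeasurable.stronglyMeasurableAtFilter
        h.continuous_power.continuousAt)
    refine antitoneOn_of_deriv_nonpos (convex_Icc s t)
      (fun r _ => (hd r).continuousAt.continuousWithinAt)
      (fun r _ => (hd r).differentiableAt.differentiableWithinAt) fun r _ => ?_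
    rw [(hd r).deriv]
    have := storage_dissipation hP (x r) (p r)
    unfold power
    linarith
  have h1 := hanti (left_mem_Icc.2 hst) (right_mem_Icc.2 hst) hst
  simp only [intervalIntegral.integral_same, add_zero] at h1
  have h2 := hup s
  have h3 := hlow t
  have hW := wsq_nonneg c (x s)
  have hS : 0 ≤ √(wsq c (x s)) * √(wsq b (p s)) := by positivity
  have hS' : 0 ≤ √(wsq c (x t)) * √(wsq b (p t)) := by positivity
  nlinarith

/-! ### Exponential decay away from the endpoints -/

/-- Dissipation on all of `[0, T]` involves the unprescribed end values `p 0` and `x T`. These are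
bounded by `ρ` plus the energy `F`, and enter only multiplied by prescribed ones, so Young's
inequality absorbs `F`. -/
theorem exists_integral_power_le_boundary {n : ℕ} {a b c : Fin n → ℝ}
    (ha : Function.Injective a) (hP : ∀ i, c i ≠ 0 → b i ≠ 0 ∨ a i < 0) :
    ∃ K : ℝ, 0 < K ∧ ∀ T ρ : ℝ, 0 < T → ∀ x p, IsHamiltonian a b c 0 x p →
      (∀ i t, c i = 0 → p t i = 0) → wsq c (x 0) ≤ ρ → wsq b (p T) ≤ ρ →
      ∫ r in (0 : ℝ)..T, power b c x p r ≤ K * ρ := by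
  obtain ⟨Λ, hΛ, hdiss⟩ := exists_integral_power_le hP
  obtain ⟨k, hk, hobs⟩ := exists_wsq_le_integral_power ha b c
  obtain ⟨E, hE, hgrow⟩ := exists_wsq_le_hamiltonian a b c
  set D := k + E with hD
  have hD0 : 0 < D := by positivity
  refine ⟨2 * (2 * Λ ^ 2 * D + 1 / 2 + Λ), by positivity, fun T ρ hT x p h hp hx0 hpT => ?_⟩
  have hρ : 0 ≤ ρ := (wsq_nonneg _ _).trans hx0
  set F := ∫ r in (0 : ℝ)..T, power b c x p r with hF
  have hF0 : 0 ≤ F := integral_power_nonneg b c x p hT.le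
  -- For `T ≤ 1` there is no room for a unit window and Grönwall from the opposite end suffices;
  -- otherwise observability on the first and last unit intervals applies.
  have hends : wsq b (p 0) ≤ D * (ρ + F) ∧ wsq c (x T) ≤ D * (ρ + F) := by
    rcases le_total T 1 with hT1 | hT1
    · obtain ⟨e1, -, e2⟩ := hgrow x p h 0 T hT.le (by linarith)
      constructor
      · refine e2.trans ?_
        calc E * (wsq b (p T) + F) ≤ E * (ρ + F) := by gcongr
          _ ≤ D * (ρ + F) := by gcongr; linarith
      · refine e1.trans ?_
        calc E * (wsq c (x 0) + F) ≤ E * (ρ + F) := by gcongr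
          _ ≤ D * (ρ + F) := by gcongr; linarith
    · have e1 := hobs x p h 0 0 le_rfl (by linarith)
      have e2 := hobs x p h (T - 1) T (by linarith) (by linarith)
      have m1 := h.integral_power_mono (s := 0) (t := T) (s' := 0) (t' := 0 + 1) le_rfl
        (by linarith) (by linarith)
      have m2 := h.integral_power_mono (s := 0) (t := T) (s' := T - 1) (t' := T - 1 + 1)
        (by linarith) (by linarith) (by linarith)
      have hkD : k * F ≤ D * (ρ + F) :=
        mul_le_mul (by linarith) (by linarith) hF0 hD0.le
      have w1 := wsq_nonneg c (x 0)
      have w2 := wsq_nonneg b (p T)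
      exact ⟨by linarith [mul_le_mul_of_nonneg_left m1 hk.le],
        by linarith [mul_le_mul_of_nonneg_left m2 hk.le]⟩
  have hd := hdiss x p h hp 0 T hT.le
  set σ := √ρ
  set τ := √(D * (ρ + F))
  have hσ : σ ^ 2 = ρ := Real.sq_sqrt hρ
  have hτ : τ ^ 2 = D * (ρ + F) := Real.sq_sqrt (by positivity)
  have h1 : √(wsq c (x 0)) * √(wsq b (p 0)) ≤ σ * τ :=
    mul_le_mul (Real.sqrt_le_sqrt hx0) (Real.sqrt_le_sqrt hends.1) (Real.sqrt_nonneg _)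
      (Real.sqrt_nonneg _)
  have h2 : √(wsq c (x T)) * √(wsq b (p T)) ≤ τ * σ :=
    mul_le_mul (Real.sqrt_le_sqrt hends.2) (Real.sqrt_le_sqrt hpT) (Real.sqrt_nonneg _)
      (Real.sqrt_nonneg _)
  have h3 : F ≤ Λ * (2 * (σ * τ) + ρ) := by
    refine hd.trans (mul_le_mul_of_nonneg_left ?_ hΛ.le)
    linarith
  -- Young's inequality, weighted so that exactly half of `F` appears on the right.
  have h4 : 2 * Λ * (σ * τ) ≤ 2 * Λ ^ 2 * D * ρ + (ρ + F) / 2 := by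
    have : 0 ≤ (2 * Λ * D * σ - τ) ^ 2 := sq_nonneg _
    have h5 : (2 * Λ * D * σ - τ) ^ 2 =
        2 * D * (2 * Λ ^ 2 * D * ρ + (ρ + F) / 2 - 2 * Λ * (σ * τ)) := by
      rw [← hσ] at hτ ⊢
      linear_combination hτ
    rw [h5] at this
    have := nonneg_of_mul_nonneg_right this (by positivity)
    linarith
  linarith

/-- Uniform bound, needed within distance 1 of the endpoints, where the geometric decay gives no
information. -/
theorem exists_wsq_le_boundary {n : ℕ} {a b c : Fin n → ℝ}
    (ha : Function.Injective a) (hP : ∀ i, c i ≠ 0 → b i ≠ 0 ∨ a i < 0) :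
    ∃ K : ℝ, 0 < K ∧ ∀ T ρ : ℝ, 0 < T → ∀ x p, IsHamiltonian a b c 0 x p →
      (∀ i t, c i = 0 → p t i = 0) → wsq c (x 0) ≤ ρ → wsq b (p T) ≤ ρ →
      ∀ t ∈ Icc 0 T, wsq c (x t) + wsq b (p t) ≤ K * ρ := by
  obtain ⟨k, hk, hobs⟩ := exists_wsq_le_integral_power ha b c
  obtain ⟨E, hE, hgrow⟩ := exists_wsq_le_hamiltonian a b c
  obtain ⟨K, hK, hF⟩ := exists_integral_power_le_boundary ha hP
  refine ⟨k * K + 2 * E * (1 + K), by positivity, fun T ρ hT x p h hp hx0 hpT t ht => ?_⟩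
  have hρ : 0 ≤ ρ := (wsq_nonneg _ _).trans hx0
  have hF := hF T ρ hT x p h hp hx0 hpT
  rcases le_total T 1 with hT1 | hT1
  · have e1 := (hgrow x p h 0 t ht.1 (by linarith [ht.2])).1
    have e2 := (hgrow x p h t T ht.2 (by linarith [ht.1])).2.2
    have m1 := h.integral_power_mono le_rfl ht.1 ht.2
    have m2 := h.integral_power_mono ht.1 ht.2 le_rfl
    have f1 : wsq c (x t) ≤ E * (ρ + K * ρ) := e1.trans (by gcongr; linarith)
    have f2 : wsq b (p t) ≤ E * (ρ + K * ρ) := e2.trans (by gcongr; linarith)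
    have : 0 ≤ k * K * ρ := by positivity
    linarith
  · obtain ⟨s, h0, h1, h2, h3⟩ : ∃ s, 0 ≤ s ∧ s + 1 ≤ T ∧ s ≤ t ∧ t ≤ s + 1 := by
      rcases le_total t (T - 1) with h | h
      · exact ⟨t, ht.1, by linarith, le_rfl, by linarith⟩
      · exact ⟨T - 1, by linarith, by linarith, h, by linarith [ht.2]⟩
    have e := hobs x p h s t h2 h3
    have m := h.integral_power_mono h0 (by linarith) h1
    have : 0 ≤ 2 * E * (1 + K) * ρ := by positivity
    have := mul_le_mul_of_nonneg_left (m.trans hF) hk.le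
    linarith

/-- Hole filling: dissipation and observability give `I₂ ≤ κ * (I₁ + I₃)` for the inner energy `I₂`
and the adjoining unit intervals. Adding `κ * I₂` to both sides gives the ratio `κ / (1 + κ) < 1`.
-/
theorem exists_integral_power_le_geometric {n : ℕ} {a b c : Fin n → ℝ}
    (ha : Function.Injective a) (hP : ∀ i, c i ≠ 0 → b i ≠ 0 ∨ a i < 0) :
    ∃ θ : ℝ, 0 < θ ∧ θ < 1 ∧ ∀ T : ℝ, ∀ x p, IsHamiltonian a b c 0 x p →
      (∀ i t, c i = 0 → p t i = 0) → ∀ m : ℕ, 2 * (m : ℝ) ≤ T →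
      ∫ r in (m : ℝ)..(T - m), power b c x p r ≤
        θ ^ m * ∫ r in (0 : ℝ)..T, power b c x p r := by
  obtain ⟨Λ, hΛ, hdiss⟩ := exists_integral_power_le hP
  obtain ⟨k, hk, hobs⟩ := exists_wsq_le_integral_power ha b c
  set κ := 2 * Λ * k with hκ
  have hκ0 : 0 < κ := by positivity
  refine ⟨κ / (1 + κ), by positivity, by rw [div_lt_one (by positivity)]; linarith,
    fun T x p h hp m => ?_⟩
  induction m with
  | zero => simp
  | succ m ih =>
    intro hm
    push_cast at hm ⊢
    have ih := ih (by linarith)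
    set P := power b c x p
    have hd := hdiss x p h hp (m + 1) (T - (m + 1)) (by linarith)
    have e1 := hobs x p h m (m + 1) (by linarith) le_rfl
    have e2 := hobs x p h (T - (m + 1)) (T - (m + 1)) le_rfl (by linarith)
    have hadd : (∫ r in (m : ℝ)..(m + 1), P r) + (∫ r in (m + 1 : ℝ)..(T - (m + 1)), P r) +
        ∫ r in (T - (m + 1) : ℝ)..(T - (m + 1) + 1), P r = ∫ r in (m : ℝ)..(T - m), P r := by
      rw [intervalIntegral.integral_add_adjacent_intervals (h.intervalIntegrable_power _ _)
        (h.intervalIntegrable_power _ _), intervalIntegral.integral_add_adjacent_intervals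
        (h.intervalIntegrable_power _ _) (h.intervalIntegrable_power _ _)]
      congr 1
      ring
    have hsq : ∀ r, √(wsq c (x r)) * √(wsq b (p r)) + wsq c (x r) ≤
        2 * (wsq c (x r) + wsq b (p r)) := by
      intro r
      have w1 := wsq_nonneg c (x r)
      have w2 := wsq_nonneg b (p r)
      nlinarith [sq_nonneg (√(wsq c (x r)) - √(wsq b (p r))), Real.sq_sqrt w1, Real.sq_sqrt w2]
    set W := T - (m + 1) with hW
    have s1 := hsq (m + 1)
    have s2 := hsq W
    have w3 := wsq_nonneg c (x W)
    set I₁ := ∫ r in (m : ℝ)..(m + 1), P r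
    set I₂ := ∫ r in (m + 1 : ℝ)..W, P r
    set I₃ := ∫ r in (W : ℝ)..(W + 1), P r
    have hd' : I₂ ≤ κ * (I₁ + I₃) := by
      calc I₂ ≤ Λ * (2 * (k * I₁) + 2 * (k * I₃)) := 
              hd.trans (mul_le_mul_of_nonneg_left (by linarith) hΛ.le)
        _ = κ * (I₁ + I₃) := by rw [hκ]; ring
    have h5 : I₂ ≤ κ / (1 + κ) * (I₁ + I₂ + I₃) := by
      rw [div_mul_eq_mul_div, le_div_iff₀ (by positivity)]
      linarith
    rw [hadd] at h5
    refine h5.trans ?_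
    rw [pow_succ', mul_assoc]
    gcongr

theorem exists_wsq_le_exp {n : ℕ} {a b c : Fin n → ℝ}
    (ha : Function.Injective a) (hP : ∀ i, c i ≠ 0 → b i ≠ 0 ∨ a i < 0) :
    ∃ ν : ℝ, 0 < ν ∧ ∃ K : ℝ, 0 < K ∧ ∀ T ρ : ℝ, 0 < T → ∀ x p, IsHamiltonian a b c 0 x p →
      (∀ i t, c i = 0 → p t i = 0) → wsq c (x 0) ≤ ρ → wsq b (p T) ≤ ρ →
      ∀ t ∈ Icc 0 T, wsq c (x t) + wsq b (p t) ≤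
        K * ρ * (Real.exp (-ν * t) + Real.exp (-ν * (T - t))) := by
  obtain ⟨k, hk, hobs⟩ := exists_wsq_le_integral_power ha b c
  obtain ⟨K₁, hK₁, hF⟩ := exists_integral_power_le_boundary ha hP
  obtain ⟨K₂, hK₂, hM⟩ := exists_wsq_le_boundary ha hP
  obtain ⟨θ, hθ, hθ1, hgeo⟩ := exists_integral_power_le_geometric ha hP
  have hlog : Real.log θ < 0 := Real.log_neg hθ hθ1
  refine ⟨-Real.log θ, by linarith, (K₂ + k * K₁) / θ ^ 2, by positivity,
    fun T ρ hT x p h hp hx0 hpT t ht => ?_⟩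
  have hρ : 0 ≤ ρ := (wsq_nonneg _ _).trans hx0
  -- The decay is used with `m = j - 1`, so that the window `[t, t + 1]` lies in `[m, T - m]`. This
  -- shift and the rounding of the floor each cost a factor `θ`, whence `θ ^ 2` in the constant.
  set j := ⌊min t (T - t)⌋₊ with hj
  have hmin : 0 ≤ min t (T - t) := le_min ht.1 (by linarith [ht.2])
  have hj1 : (j : ℝ) ≤ min t (T - t) := Nat.floor_le hmin
  have hj2 : min t (T - t) < j + 1 := Nat.lt_floor_add_one _
  have hjt := hj1.trans (min_le_left _ _)
  have hjT := hj1.trans (min_le_right _ _)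
  have hmain : wsq c (x t) + wsq b (p t) ≤ (K₂ + k * K₁) / θ * ρ * θ ^ j := by
    rcases Nat.eq_zero_or_pos j with h0 | h0
    · rw [h0, pow_zero, mul_one]
      refine (hM T ρ hT x p h hp hx0 hpT t ht).trans ?_
      gcongr
      rw [le_div_iff₀ hθ]
      nlinarith [mul_pos hk hK₁]
    · obtain ⟨m, hm⟩ : ∃ m, j = m + 1 := ⟨j - 1, by omega⟩
      rw [hm] at hjt hjT ⊢
      push_cast at hjt hjT
      have e := hobs x p h t t le_rfl (by linarith)
      have mono := h.integral_power_mono (s := m) (t := T - m) (s' := t) (t' := t + 1)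
        (by linarith) (by linarith) (by linarith)
      have g := hgeo T x p h hp m (by linarith)
      have f := hF T ρ hT x p h hp hx0 hpT
      calc wsq c (x t) + wsq b (p t) ≤ k * (θ ^ m * (K₁ * ρ)) := by
            refine e.trans ?_
            gcongr
            exact mono.trans (g.trans (by gcongr))
        _ ≤ (K₂ + k * K₁) * ρ * θ ^ m := by
            have : 0 ≤ K₂ * ρ * θ ^ m := by positivity
            linarith
        _ = _ := by rw [pow_succ]; field_simp
  have hpow : θ ^ j ≤ θ⁻¹ * Real.exp (Real.log θ * min t (T - t)) := by
    rw [le_inv_mul_iff₀ hθ, ← pow_succ']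
    calc θ ^ (j + 1) = Real.exp (Real.log θ * (j + 1)) := by
          rw [mul_comm, ← Nat.cast_succ, Real.exp_nat_mul, Real.exp_log hθ]
      _ ≤ _ := Real.exp_le_exp.2 (mul_le_mul_of_nonpos_left hj2.le hlog.le)
  have hexp : Real.exp (Real.log θ * min t (T - t)) ≤
      Real.exp (Real.log θ * t) + Real.exp (Real.log θ * (T - t)) := by
    rcases min_choice t (T - t) with h | h <;> rw [h]
    · linarith [Real.exp_pos (Real.log θ * (T - t))]
    · linarith [Real.exp_pos (Real.log θ * t)]
  rw [neg_neg]
  calc wsq c (x t) + wsq b (p t) ≤ (K₂ + k * K₁) / θ * ρ * θ ^ j := hmain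
    _ ≤ (K₂ + k * K₁) / θ * ρ * (θ⁻¹ * (Real.exp (Real.log θ * t) +
        Real.exp (Real.log θ * (T - t)))) := by
        gcongr
        exact hpow.trans (by gcongr)
    _ = _ := by field_simp

/-- Variation of constants in energy form: `(f²)' ≤ a * f² + g² / |a|`. The condition `ν ≤ -a / 2`
keeps the decay of the forcing away from resonance with that of the homogeneous solution. -/
theorem sq_le_exp_of_stable {a ν K T : ℝ} (hν : 0 < ν) (haν : ν ≤ -a / 2)
    {f g : ℝ → ℝ} (hf : ∀ t, HasDerivAt f (a * f t + g t) t)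
    (hg : ∀ t ∈ Icc 0 T, g t ^ 2 ≤ K * (Real.exp (-ν * t) + Real.exp (-ν * (T - t)))) (hK : 0 ≤ K) :
    ∀ t ∈ Icc 0 T, f t ^ 2 ≤
      (f 0 ^ 2 + 4 * K / a ^ 2) * (Real.exp (-ν * t) + Real.exp (-ν * (T - t))) := by
  intro t ht
  set α := -a with hα
  have haα : a = -α := by simp [hα]
  have hα0 : 0 < α := by linarith
  have hανp : 0 < α - ν := by linarith
  -- The subtracted term is an explicit antiderivative of the bound for `exp (α * r) * g ^ 2 / α`,
  -- which makes `H` nonincreasing.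
  set H : ℝ → ℝ := fun r => Real.exp (α * r) * f r ^ 2 - K / α *
    (Real.exp ((α - ν) * r) / (α - ν) + Real.exp ((α + ν) * r - ν * T) / (α + ν)) with hH
  have hd : ∀ r, HasDerivAt H (Real.exp (α * r) * (α * f r ^ 2 + 2 * f r * (a * f r + g r)) -
      K / α * (Real.exp ((α - ν) * r) + Real.exp ((α + ν) * r - ν * T))) r := by
    intro r
    have h1 : HasDerivAt (fun r => Real.exp (α * r)) (Real.exp (α * r) * α) r := by
      simpa using ((hasDerivAt_id r).const_mul α).exp
    have h2 : HasDerivAt (fun r => Real.exp ((α - ν) * r)) (Real.exp ((α - ν) * r) * (α - ν)) r := by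
      simpa using ((hasDerivAt_id r).const_mul (α - ν)).exp
    have h3 : HasDerivAt (fun r => Real.exp ((α + ν) * r - ν * T))
        (Real.exp ((α + ν) * r - ν * T) * (α + ν)) r := by
      simpa using (((hasDerivAt_id r).const_mul (α + ν)).sub_const (ν * T)).exp
    have h4 := (h1.mul ((hf r).pow 2)).sub
      (((h2.div_const (α - ν)).add (h3.div_const (α + ν))).const_mul (K / α))
    refine h4.congr_deriv ?_
    have : α + ν ≠ 0 := by positivity
    simp only [Pi.pow_apply]
    push_cast
    field_simp
  have hanti : AntitoneOn H (Icc 0 T) := by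
    refine antitoneOn_of_deriv_nonpos (convex_Icc 0 T)
      (fun r _ => (hd r).continuousAt.continuousWithinAt)
      (fun r _ => (hd r).differentiableAt.differentiableWithinAt) fun r hr => ?_
    rw [(hd r).deriv]
    have hg' := hg r (interior_subset hr)
    have e1 : Real.exp ((α - ν) * r) = Real.exp (α * r) * Real.exp (-ν * r) := by
      rw [← Real.exp_add]; ring_nf
    have e2 : Real.exp ((α + ν) * r - ν * T) = Real.exp (α * r) * Real.exp (-ν * (T - r)) := by
      rw [← Real.exp_add]; ring_nf
    rw [e1, e2]
    have h5 : α * f r ^ 2 + 2 * f r * (a * f r + g r) ≤ g r ^ 2 / α := by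
      rw [haα, le_div_iff₀ hα0]
      nlinarith [sq_nonneg (α * f r - g r)]
    have h6 : g r ^ 2 / α ≤ K / α * (Real.exp (-ν * r) + Real.exp (-ν * (T - r))) := by
      rw [div_mul_eq_mul_div]
      gcongr
    nlinarith [mul_le_mul_of_nonneg_left (h5.trans h6) (Real.exp_pos (α * r)).le]
  have h7 := hanti (left_mem_Icc.2 (ht.1.trans ht.2)) ht ht.1
  simp only [hH, mul_zero, Real.exp_zero, one_mul, zero_sub] at h7
  have h8 : 0 ≤ K / α * (1 / (α - ν) + Real.exp (-(ν * T)) / (α + ν)) := by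
    have : 0 < α + ν := by linarith
    positivity
  have e1 : Real.exp ((α - ν) * t) = Real.exp (α * t) * Real.exp (-ν * t) := by
    rw [← Real.exp_add]; ring_nf
  have e2 : Real.exp ((α + ν) * t - ν * T) = Real.exp (α * t) * Real.exp (-ν * (T - t)) := by
    rw [← Real.exp_add]; ring_nf
  rw [e1, e2] at h7
  have hX := Real.exp_pos (α * t)
  have hY := Real.exp_pos (-ν * t)
  have hZ := Real.exp_pos (-ν * (T - t))
  have d1 : Real.exp (α * t) * Real.exp (-ν * t) / (α - ν) ≤
      Real.exp (α * t) * Real.exp (-ν * t) / (α / 2) := by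
    gcongr; linarith
  have d2 : Real.exp (α * t) * Real.exp (-ν * (T - t)) / (α + ν) ≤
      Real.exp (α * t) * Real.exp (-ν * (T - t)) / (α / 2) := by
    gcongr; linarith
  have hKα : 0 ≤ K / α := by positivity
  have h9 : Real.exp (α * t) * f t ^ 2 ≤ f 0 ^ 2 + 2 * K / α ^ 2 * (Real.exp (α * t) *
      (Real.exp (-ν * t) + Real.exp (-ν * (T - t)))) := by
    have := mul_le_mul_of_nonneg_left (add_le_add d1 d2) hKα
    have e3 : K / α * (Real.exp (α * t) * Real.exp (-ν * t) / (α / 2) +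
      Real.exp (α * t) * Real.exp (-ν * (T - t)) / (α / 2)) = 2 * K / α ^ 2 * (Real.exp (α * t) *
      (Real.exp (-ν * t) + Real.exp (-ν * (T - t)))) := by field_simp
    linarith
  have h10 : f 0 ^ 2 ≤ Real.exp (α * t) * (f 0 ^ 2 * Real.exp (-ν * t)) := by
    rw [mul_comm, mul_assoc, ← Real.exp_add]
    refine le_mul_of_one_le_right (sq_nonneg _) (Real.one_le_exp ?_)
    nlinarith [mul_nonneg hανp.le ht.1]
  have h11 : f t ^ 2 ≤ f 0 ^ 2 * Real.exp (-ν * t) +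
      2 * K / α ^ 2 * (Real.exp (-ν * t) + Real.exp (-ν * (T - t))) := by
    refine le_of_mul_le_mul_left ?_ hX
    linarith
  have h12 : 0 ≤ K / α ^ 2 := by positivity
  have e4 : a ^ 2 = α ^ 2 := by rw [haα]; ring
  rw [e4, mul_div_assoc]
  rw [mul_div_assoc] at h11
  nlinarith [mul_nonneg (sq_nonneg (f 0)) hZ.le, mul_nonneg h12 hY.le, mul_nonneg h12 hZ.le]

/-! ### Solvability of the optimality system -/

/-- The derivative of `-⟨x, p⟩` is `power`. As the boundary terms vanish, so does the energy; the
adjoint is then unforced and zero. -/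
theorem IsHamiltonian.adjoint_eq_zero {n : ℕ} {a b c : Fin n → ℝ} {x p : ℝ → Fin n → ℝ}
    (h : IsHamiltonian a b c 0 x p) {T : ℝ} (hT : 0 ≤ T) (hx : x 0 = 0) (hp : p T = 0) :
    p 0 = 0 := by
  have hd : ∀ t, HasDerivAt (fun t => -∑ i, x t i * p t i) (power b c x p t) t := by
    intro t
    have := (HasDerivAt.fun_sum (u := Finset.univ) fun i _ => (h.state i t).mul (h.adjoint i t)).neg
    refine this.congr_deriv ?_
    have e : ∀ i, (a i * x t i - b i * ∑ j, b j * p t j) * p t i +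
        x t i * (-a i * p t i - c i * (∑ j, c j * x t j - 0)) =
        -((b i * p t i) * (∑ j, b j * p t j)) - (c i * x t i) * ∑ j, c j * x t j := fun i => by ring
    simp only [e, Finset.sum_sub_distrib, Finset.sum_neg_distrib, ← Finset.sum_mul]
    unfold power
    ring
  have hint : ∫ r in (0 : ℝ)..T, power b c x p r = 0 := by
    rw [intervalIntegral.integral_eq_sub_of_hasDerivAt (fun t _ => hd t)
      (h.intervalIntegrable_power _ _), hx, hp]
    simp
  ext i
  have h1 := sq_le_of_hasDerivAt_linear_backward (a := -a i) (f := fun t => p t i)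
    (g := fun t => -c i * ∑ j, c j * x t j) (continuous_const.mul h.continuous_output)
    (fun t => (h.adjoint i t).congr_deriv (by ring)) hT
  have h2 : ∫ r in (0 : ℝ)..T, (-c i * ∑ j, c j * x r j) ^ 2 ≤
      ∫ r in (0 : ℝ)..T, c i ^ 2 * power b c x p r := by
    refine intervalIntegral.integral_mono_on hT
      (((continuous_const.mul h.continuous_output).pow 2).intervalIntegrable _ _)
      ((continuous_const.mul h.continuous_power).intervalIntegrable _ _) fun r _ => ?_
    unfold power
    nlinarith [mul_nonneg (sq_nonneg (c i)) (sq_nonneg (∑ j, b j * p r j))]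
  rw [intervalIntegral.integral_const_mul, hint, mul_zero] at h2
  have h3 : p 0 i ^ 2 ≤ 0 := by
    refine h1.trans ?_
    rw [hp]
    simp only [Pi.zero_apply, ne_eq, OfNat.ofNat_ne_zero, not_false_eq_true, zero_pow, zero_add]
    exact mul_nonpos_of_nonneg_of_nonpos (Real.exp_pos _).le h2
  simpa using h3.antisymm (sq_nonneg _)

/-- The vector field of the optimality system; the last coordinate carries the target. -/
def hamiltonianField {n : ℕ} (a b c : Fin n → ℝ) :
    ((Fin n → ℝ) × (Fin n → ℝ) × ℝ) →ₗ[ℝ] ((Fin n → ℝ) × (Fin n → ℝ) × ℝ) where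
  toFun w := (fun i => a i * w.1 i - b i * ∑ j, b j * w.2.1 j,
    fun i => -a i * w.2.1 i - c i * (∑ j, c j * w.1 j - w.2.2), 0)
  map_add' v w := by
    ext i <;> simp [mul_add, Finset.sum_add_distrib] <;> ring
  map_smul' r w := by
    ext i <;> simp [mul_left_comm _ r, ← Finset.mul_sum] <;> ring

/-- Carrying the target as a constant coordinate makes the affine system linear, so the exponential
gives a flow linear in all the data. -/
theorem exists_hamiltonian_flow {n : ℕ} (a b c : Fin n → ℝ) :
    ∃ Φ : ℝ → ((Fin n → ℝ) × (Fin n → ℝ) × ℝ) →L[ℝ] ((Fin n → ℝ) × (Fin n → ℝ) × ℝ),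
      (∀ w, Φ 0 w = w) ∧ ∀ w, IsHamiltonian a b c w.2.2 (fun t => (Φ t w).1)
        (fun t => (Φ t w).2.1) := by
  set L := LinearMap.toContinuousLinearMap (hamiltonianField a b c) with hL
  have hΦ : ∀ w t, HasDerivAt (fun t : ℝ => NormedSpace.exp (t • L) w)
      (L (NormedSpace.exp (t • L) w)) t := by
    intro w t
    have := (hasDerivAt_exp_smul_const' (𝕂 := ℝ) L t).clm_apply (hasDerivAt_const t w)
    simpa using this
  have h0 : ∀ w, NormedSpace.exp ((0 : ℝ) • L) w = w := by
    intro w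
    rw [zero_smul, NormedSpace.exp_zero]
    rfl
  refine ⟨fun t => NormedSpace.exp (t • L), h0, fun w => ?_⟩
  have h1 : ∀ t, HasDerivAt (fun t : ℝ => (NormedSpace.exp (t • L) w).1)
      (L (NormedSpace.exp (t • L) w)).1 t := fun t =>
    (ContinuousLinearMap.fst ℝ (Fin n → ℝ) ((Fin n → ℝ) × ℝ)).hasFDerivAt.comp_hasDerivAt t (hΦ w t)
  have h2 : ∀ t, HasDerivAt (fun t : ℝ => (NormedSpace.exp (t • L) w).2)
      (L (NormedSpace.exp (t • L) w)).2 t := fun t =>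
    (ContinuousLinearMap.snd ℝ (Fin n → ℝ) ((Fin n → ℝ) × ℝ)).hasFDerivAt.comp_hasDerivAt t (hΦ w t)
  have h3 : ∀ t, HasDerivAt (fun t : ℝ => (NormedSpace.exp (t • L) w).2.1)
      (L (NormedSpace.exp (t • L) w)).2.1 t := fun t =>
    (ContinuousLinearMap.fst ℝ (Fin n → ℝ) ℝ).hasFDerivAt.comp_hasDerivAt t (h2 t)
  have h4 : ∀ t, HasDerivAt (fun t : ℝ => (NormedSpace.exp (t • L) w).2.2) 0 t := fun t =>
    (ContinuousLinearMap.snd ℝ (Fin n → ℝ) ℝ).hasFDerivAt.comp_hasDerivAt t (h2 t)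
  have h5 : ∀ t : ℝ, (NormedSpace.exp (t • L) w).2.2 = w.2.2 := by
    intro t
    rw [is_const_of_deriv_eq_zero (fun r => (h4 r).differentiableAt) (fun r => (h4 r).deriv) t 0,
      h0]
  constructor
  · intro i t
    exact hasDerivAt_pi.1 (h1 t) i
  · intro i t
    refine (hasDerivAt_pi.1 (h3 t) i).congr_deriv ?_
    rw [← h5 t]
    rfl

/-- Shooting: the linear map from `p 0` to `p T` with zero state and target is injective, hence
surjective, and `p 0` can be chosen to cancel the contribution of `x₀` and `z`. -/
theorem exists_isHamiltonian {n : ℕ} (a b c : Fin n → ℝ) {T : ℝ} (hT : 0 ≤ T) (x₀ : Fin n → ℝ)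
    (z : ℝ) : ∃ x p, IsHamiltonian a b c z x p ∧ x 0 = x₀ ∧ p T = 0 := by
  obtain ⟨Φ, h0, hΦ⟩ := exists_hamiltonian_flow a b c
  set S : (Fin n → ℝ) →ₗ[ℝ] (Fin n → ℝ) :=
    LinearMap.fst ℝ _ _ ∘ₗ LinearMap.snd ℝ _ _ ∘ₗ (Φ T).toLinearMap ∘ₗ LinearMap.inr ℝ _ _ ∘ₗ
      LinearMap.inl ℝ _ _ with hS
  have hinj : Function.Injective S := by
    rw [← LinearMap.ker_eq_bot, LinearMap.ker_eq_bot']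
    intro p hp
    have := (hΦ (0, p, 0)).adjoint_eq_zero hT (by simp [h0]) hp
    simpa [h0] using this
  obtain ⟨p₀, hp₀⟩ := LinearMap.injective_iff_surjective.1 hinj (-(Φ T (x₀, 0, z)).2.1)
  refine ⟨_, _, hΦ (x₀, p₀, z), by simp [h0], ?_⟩
  have e : ((x₀, p₀, z) : (Fin n → ℝ) × (Fin n → ℝ) × ℝ) = (0, p₀, 0) + (x₀, 0, z) := by simp
  have hp₀' : (Φ T (0, p₀, 0)).2.1 = -(Φ T (x₀, 0, z)).2.1 := hp₀
  change (Φ T (x₀, p₀, z)).2.1 = 0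
  rw [e, map_add, Prod.snd_add, Prod.fst_add, hp₀', neg_add_cancel]

/-! ### Testing a trajectory against smooth functions -/

/-- Integration by parts; `η` is only absolutely continuous because controls are merely `L²`. -/
theorem integral_deriv_mul_add_mul {η h q q' : ℝ → ℝ} {t : ℝ} (ht : 0 ≤ t)
    (hh : IntervalIntegrable h volume 0 t) (hη : ∀ s ∈ Icc 0 t, η s = ∫ r in (0 : ℝ)..s, h r)
    (hq : ∀ s, HasDerivAt q (q' s) s) (hq' : Continuous q') :
    ∫ s in (0 : ℝ)..t, (q' s * η s + q s * h s) = q t * η t := by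
  have hqd : deriv q = q' := funext fun s => (hq s).deriv
  have h1 : AbsolutelyContinuousOnInterval q 0 t :=
    (contDiff_one_iff_deriv.2 ⟨fun s => (hq s).differentiableAt, by rwa [hqd]⟩).contDiffOn
      |>.absolutelyContinuousOnInterval
  have h2 := hh.absolutelyContinuousOnInterval_intervalIntegral (c := 0) left_mem_uIcc
  have h3 := h1.integral_deriv_mul_eq_sub h2
  rw [intervalIntegral.integral_same, mul_zero, sub_zero, ← hη t ⟨ht, le_rfl⟩] at h3
  rw [← h3]
  refine intervalIntegral.integral_congr_ae ?_
  filter_upwards [hh.ae_hasDerivAt_integral] with s hs hst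
  have hsu : s ∈ uIcc 0 t := uIoc_subset_uIcc hst
  rw [hqd, (hs hsu 0 left_mem_uIcc).deriv, hη s (by rwa [uIcc_of_le ht] at hsu)]

/-- The first variation of the cost vanishes in every admissible direction `(w, η)`: test the
equation of `η` against the adjoint. -/
theorem IsHamiltonian.integral_cross {n : ℕ} {a b c : Fin n → ℝ} {z : ℝ} {x p : ℝ → Fin n → ℝ}
    (h : IsHamiltonian a b c z x p) {T : ℝ} (hT : 0 ≤ T) (hp : p T = 0)
    {η : ℝ → Fin n → ℝ} {w : ℝ → ℝ} (hw : IntervalIntegrable w volume 0 T)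
    (hη : ∀ i, ContinuousOn (fun t => η t i) (Icc 0 T))
    (heq : ∀ i, ∀ t ∈ Icc 0 T, η t i = ∫ s in (0 : ℝ)..t, (a i * η s i + b i * w s)) :
    ∫ s in (0 : ℝ)..T, ((∑ j, c j * x s j - z) * (∑ j, c j * η s j) - (∑ j, b j * p s j) * w s)
      = 0 := by
  have hηi : ∀ i, IntervalIntegrable (fun t => η t i) volume 0 T := fun i =>
    ContinuousOn.intervalIntegrable (by rw [uIcc_of_le hT]; exact hη i)
  have hh : ∀ i, IntervalIntegrable (fun s => a i * η s i + b i * w s) volume 0 T := fun i =>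
    ((hηi i).const_mul _).add (hw.const_mul _)
  have hq' : ∀ i, Continuous fun t => -a i * p t i - c i * (∑ j, c j * x t j - z) := fun i => by
    have := h.continuous_adjoint i
    have := h.continuous_output
    fun_prop
  have key : ∀ i, ∫ s in (0 : ℝ)..T, ((-a i * p s i - c i * (∑ j, c j * x s j - z)) * η s i +
      p s i * (a i * η s i + b i * w s)) = 0 := by
    intro i
    rw [integral_deriv_mul_add_mul hT (hh i) (heq i) (h.adjoint i) (hq' i), hp]
    simp
  have hsum := Finset.sum_eq_zero (s := Finset.univ) fun i _ => key i
  rw [← intervalIntegral.integral_finsetSum] at hsum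
  · rw [← neg_eq_zero, ← intervalIntegral.integral_neg, ← hsum]
    congr 1
    ext s
    rw [Finset.mul_sum, Finset.sum_mul, ← Finset.sum_sub_distrib, ← Finset.sum_neg_distrib]
    exact Finset.sum_congr rfl fun i _ => by ring
  · intro i _
    refine ((hηi i).continuousOn_mul (hq' i).continuousOn).add
      ((hh i).continuousOn_mul (h.continuous_adjoint i).continuousOn)

theorem eq_zero_of_eq_integral {a T : ℝ} {η : ℝ → ℝ} (hη : ContinuousOn η (Icc 0 T))
    (heq : ∀ t ∈ Icc 0 T, η t = ∫ s in (0 : ℝ)..t, a * η s) : ∀ t ∈ Icc 0 T, η t = 0 := by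
  intro t ht
  have hsub : Icc 0 t ⊆ Icc 0 T := Icc_subset_Icc_right ht.2
  have hi : IntervalIntegrable (fun s => a * η s) volume 0 t :=
    ContinuousOn.intervalIntegrable (by
      rw [uIcc_of_le ht.1]; exact continuousOn_const.mul (hη.mono hsub))
  have := integral_deriv_mul_add_mul ht.1 hi (fun s hs => heq s (hsub hs))
    (q := fun s => Real.exp (-a * s)) (q' := fun s => Real.exp (-a * s) * (-a))
    (fun s => by simpa using ((hasDerivAt_id s).const_mul (-a)).exp) (by fun_prop)
  rw [intervalIntegral.integral_congr (g := fun _ => 0) (fun s _ => by ring)] at this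
  simp only [intervalIntegral.integral_zero] at this
  exact (mul_eq_zero.1 this.symm).resolve_left (Real.exp_pos _).ne'

/-! ### The linear quadratic problem in coordinates -/

/-- The `n × 1` matrix with column `b`. -/
def colMatrix {n : ℕ} (b : Fin n → ℝ) : Matrix (Fin n) (Fin 1) ℝ := fun i _ => b i

/-- The `1 × n` matrix with row `c`. -/
def rowMatrix {n : ℕ} (c : Fin n → ℝ) : Matrix (Fin 1) (Fin n) ℝ := fun _ j => c j

theorem act_diagonal_apply {n : ℕ} (a : Fin n → ℝ) (x : EuclideanSpace ℝ (Fin n)) (i : Fin n) :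
    act (Matrix.diagonal a) x i = a i * x i := by
  simp [act, Matrix.toLpLin_apply, Matrix.mulVec_diagonal]

theorem act_colMatrix_apply {n : ℕ} (b : Fin n → ℝ) (u : EuclideanSpace ℝ (Fin 1)) (i : Fin n) :
    act (colMatrix b) u i = b i * u 0 := by
  simp [act, Matrix.toLpLin_apply, Matrix.mulVec, dotProduct, colMatrix]

theorem act_rowMatrix_apply {n : ℕ} (c : Fin n → ℝ) (x : EuclideanSpace ℝ (Fin n)) (i : Fin 1) :
    act (rowMatrix c) x i = ∑ j, c j * x j := by
  simp [act, Matrix.toLpLin_apply, Matrix.mulVec, dotProduct, rowMatrix]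

theorem norm_sq_fin_one (u : EuclideanSpace ℝ (Fin 1)) : ‖u‖ ^ 2 = u 0 ^ 2 := by
  simp [EuclideanSpace.real_norm_sq_eq]

theorem norm_fin_one (u : EuclideanSpace ℝ (Fin 1)) : ‖u‖ = |u 0| := by
  rw [← abs_norm, ← sq_eq_sq_iff_abs_eq_abs, norm_sq_fin_one]

theorem cost_rowMatrix {n : ℕ} (c : Fin n → ℝ) (z : EuclideanSpace ℝ (Fin 1)) (T : ℝ)
    (u : ℝ → EuclideanSpace ℝ (Fin 1)) (x : ℝ → EuclideanSpace ℝ (Fin n)) :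
    cost (rowMatrix c) z T u x =
      1 / 2 * ∫ t in (0 : ℝ)..T, (u t 0 ^ 2 + (∑ j, c j * x t j - z 0) ^ 2) := by
  simp only [cost, norm_sq_fin_one, PiLp.sub_apply, act_rowMatrix_apply]

theorem steadyCost_rowMatrix {n : ℕ} (c : Fin n → ℝ) (z : EuclideanSpace ℝ (Fin 1))
    (u : EuclideanSpace ℝ (Fin 1)) (x : EuclideanSpace ℝ (Fin n)) :
    steadyCost (rowMatrix c) z u x = 1 / 2 * (u 0 ^ 2 + (∑ j, c j * x j - z 0) ^ 2) := by
  simp only [steadyCost, norm_sq_fin_one, PiLp.sub_apply, act_rowMatrix_apply]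

theorem intervalIntegrable_of_memLp {v : ℝ → ℝ} {T : ℝ} (hT : 0 ≤ T)
    (hv : MemLp v 2 (volume.restrict (Ioo 0 T))) : IntervalIntegrable v volume 0 T :=
  (intervalIntegrable_iff_integrableOn_Ioo_of_le hT).2 (hv.integrable (by norm_num))

theorem intervalIntegrable_sq_of_memLp {v : ℝ → ℝ} {T : ℝ} (hT : 0 ≤ T)
    (hv : MemLp v 2 (volume.restrict (Ioo 0 T))) :
    IntervalIntegrable (fun t => v t ^ 2) volume 0 T :=
  (intervalIntegrable_iff_integrableOn_Ioo_of_le hT).2 hv.integrable_sq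

theorem isTrajectory_iff {n : ℕ} {a b : Fin n → ℝ} {x₀ : EuclideanSpace ℝ (Fin n)} {T : ℝ}
    (hT : 0 ≤ T) {u : ℝ → EuclideanSpace ℝ (Fin 1)} {x : ℝ → EuclideanSpace ℝ (Fin n)} :
    IsTrajectory (Matrix.diagonal a) (colMatrix b) x₀ T u x ↔
      MemLp (fun t => u t 0) 2 (volume.restrict (Ioo 0 T)) ∧
      (∀ i, ContinuousOn (fun t => x t i) (Icc 0 T)) ∧
      ∀ i, ∀ t ∈ Icc 0 T, x t i = x₀ i + ∫ s in (0 : ℝ)..t, (a i * x s i + b i * u s 0) := by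
  have h1 : MemLp u 2 (volume.restrict (Ioo 0 T)) ↔
      MemLp (fun t => u t 0) 2 (volume.restrict (Ioo 0 T)) := by
    rw [memLp_piLp_iff, Fin.forall_fin_one]
  have h2 : ContinuousOn x (Icc 0 T) ↔ ∀ i, ContinuousOn (fun t => x t i) (Icc 0 T) :=
    ⟨fun h i => (EuclideanSpace.proj i).continuous.comp_continuousOn h, fun h =>
      (PiLp.continuous_toLp 2 _).comp_continuousOn (continuousOn_pi.2 h)⟩
  unfold IsTrajectory
  rw [h1, h2]
  refine and_congr_right fun hu => and_congr_right fun hx => ?_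
  have hcoord : ∀ t ∈ Icc 0 T, ∀ i,
      (x₀ + ∫ s in (0 : ℝ)..t, (act (Matrix.diagonal a) (x s) + act (colMatrix b) (u s))) i =
        x₀ i + ∫ s in (0 : ℝ)..t, (a i * x s i + b i * u s 0) := by
    intro t ht i
    rw [PiLp.add_apply, intervalIntegral.integral_of_le ht.1,
      intervalIntegral.integral_of_le ht.1, eval_integral_piLp]
    · simp only [PiLp.add_apply, act_diagonal_apply, act_colMatrix_apply]
    · intro j
      simp only [PiLp.add_apply, act_diagonal_apply, act_colMatrix_apply]
      have i1 : IntervalIntegrable (fun s => x s j) volume 0 t :=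
        ContinuousOn.intervalIntegrable (by
          rw [uIcc_of_le ht.1]; exact (hx j).mono (Icc_subset_Icc_right ht.2))
      have i2 : IntervalIntegrable (fun s => u s 0) volume 0 t :=
        (intervalIntegrable_of_memLp hT hu).mono_set (by
          rw [uIcc_of_le ht.1, uIcc_of_le hT]; exact Icc_subset_Icc_right ht.2)
      exact ((i1.const_mul _).add (i2.const_mul _)).1
  constructor
  · intro h i t ht
    rw [← hcoord t ht i, ← h t ht]
  · intro h t ht
    ext i
    rw [hcoord t ht i, h i t ht]

/-! ### Optimal pairs are the solutions of the optimality system -/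

section Optimality

variable {n : ℕ} {a b c : Fin n → ℝ} {z : EuclideanSpace ℝ (Fin 1)} {T : ℝ}
  {x p : ℝ → Fin n → ℝ}

/-- The control determined by the adjoint state. -/
noncomputable def adjointControl {n : ℕ} (b : Fin n → ℝ) (p : ℝ → Fin n → ℝ) (t : ℝ) :
    EuclideanSpace ℝ (Fin 1) :=
  WithLp.toLp 2 fun _ => -∑ j, b j * p t j

theorem adjointControl_apply {n : ℕ} (b : Fin n → ℝ) (p : ℝ → Fin n → ℝ) (t : ℝ) (i : Fin 1) :
    adjointControl b p t i = -∑ j, b j * p t j := rfl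

theorem IsHamiltonian.isTrajectory {ζ : ℝ} (h : IsHamiltonian a b c ζ x p) (hT : 0 ≤ T) :
    IsTrajectory (Matrix.diagonal a) (colMatrix b) (WithLp.toLp 2 (x 0)) T
      (adjointControl b p) (fun t => WithLp.toLp 2 (x t)) := by
  rw [isTrajectory_iff hT]
  refine ⟨?_, fun i => (h.continuous_state i).continuousOn, fun i t _ => ?_⟩
  · have hc : Continuous fun t => -∑ j, b j * p t j := h.continuous_input.neg
    obtain ⟨M, hM⟩ := isCompact_Icc.exists_bound_of_continuousOn (s := Icc 0 T) hc.continuousOn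
    refine MemLp.of_bound hc.aestronglyMeasurable M ?_
    filter_upwards [ae_restrict_mem measurableSet_Ioo] with t ht
    exact hM t (Ioo_subset_Icc_self ht)
  · have hx := h.continuous_state i
    have hu := h.continuous_input
    simp only [adjointControl_apply, mul_neg]
    rw [intervalIntegral.integral_eq_sub_of_hasDerivAt
      (fun s _ => (h.state i s).congr_deriv (sub_eq_add_neg _ _))
      (Continuous.intervalIntegrable (by fun_prop) _ _)]
    ring

/-- The cost is quadratic and its linear term at an extremal is zero by `integral_cross`. The
remaining square yields both optimality and uniqueness. -/
theorem IsHamiltonian.cost_eq (h : IsHamiltonian a b c (z 0) x p) (hT : 0 ≤ T) (hp : p T = 0)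
    {v : ℝ → EuclideanSpace ℝ (Fin 1)} {y : ℝ → EuclideanSpace ℝ (Fin n)}
    (hv : IsTrajectory (Matrix.diagonal a) (colMatrix b) (WithLp.toLp 2 (x 0)) T v y) :
    IntervalIntegrable (fun t => (v t 0 + ∑ j, b j * p t j) ^ 2) volume 0 T ∧
    IntervalIntegrable (fun t => (∑ j, c j * (y t j - x t j)) ^ 2) volume 0 T ∧
    cost (rowMatrix c) z T v y =
      cost (rowMatrix c) z T (adjointControl b p)
        (fun t => WithLp.toLp 2 (x t)) +
      1 / 2 * ∫ t in (0 : ℝ)..T, ((v t 0 + ∑ j, b j * p t j) ^ 2 +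
        (∑ j, c j * (y t j - x t j)) ^ 2) := by
  obtain ⟨hv2, hyc, hy⟩ := (isTrajectory_iff hT).1 hv
  obtain ⟨-, -, hx⟩ := (isTrajectory_iff hT).1 (h.isTrajectory hT)
  have hvi := intervalIntegrable_of_memLp hT hv2
  have hvs := intervalIntegrable_sq_of_memLp hT hv2
  have hβ := h.continuous_input
  have hCx := h.continuous_output
  have hηc : ∀ i, ContinuousOn (fun t => y t i - x t i) (Icc 0 T) := fun i =>
    (hyc i).sub (h.continuous_state i).continuousOn
  have hCη : ContinuousOn (fun t => ∑ j, c j * (y t j - x t j)) (uIcc 0 T) := by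
    rw [uIcc_of_le hT]
    exact continuousOn_finsetSum _ fun i _ => continuousOn_const.mul (hηc i)
  have hw : IntervalIntegrable (fun t => v t 0 + ∑ j, b j * p t j) volume 0 T :=
    hvi.add (hβ.intervalIntegrable _ _)
  have hw2 : IntervalIntegrable (fun t => (v t 0 + ∑ j, b j * p t j) ^ 2) volume 0 T := by
    have := (hvs.add ((hvi.mul_continuousOn hβ.continuousOn).const_mul 2)).add
      ((hβ.pow 2).intervalIntegrable 0 T)
    refine this.congr fun t _ => ?_
    simp only [Pi.pow_apply]
    ring
  have heq : ∀ i, ∀ t ∈ Icc 0 T, y t i - x t i = ∫ s in (0 : ℝ)..t,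
      (a i * (y s i - x s i) + b i * (v s 0 + ∑ j, b j * p s j)) := by
    intro i t ht
    have hsub : uIcc 0 t ⊆ uIcc 0 T := by
      rw [uIcc_of_le ht.1, uIcc_of_le hT]; exact Icc_subset_Icc_right ht.2
    have i1 : IntervalIntegrable (fun s => y s i) volume 0 t :=
      ContinuousOn.intervalIntegrable
        (by rw [uIcc_of_le ht.1]; exact (hyc i).mono (Icc_subset_Icc_right ht.2))
    have i2 := hvi.mono_set hsub
    have hxc := h.continuous_state i
    have e1 := hy i t ht
    have e2 := hx i t ht
    simp only [adjointControl_apply] at e1 e2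
    rw [e1, e2, add_sub_add_left_eq_sub, ← intervalIntegral.integral_sub
      ((i1.const_mul _).add (i2.const_mul _)) (Continuous.intervalIntegrable (by fun_prop) _ _)]
    congr 1
    ext s
    ring
  have hcross := h.integral_cross hT hp (η := fun t i => y t i - x t i) hw hηc heq
  refine ⟨hw2, (hCη.pow 2).intervalIntegrable, ?_⟩
  have hci : IntervalIntegrable (fun s => (∑ j, c j * x s j - z 0) *
      (∑ j, c j * (y s j - x s j)) - (∑ j, b j * p s j) * (v s 0 + ∑ j, b j * p s j))
      volume 0 T :=
    (((hCx.sub continuous_const).continuousOn.mul hCη).intervalIntegrable).sub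
      (hw.continuousOn_mul hβ.continuousOn)
  have hη2 : IntervalIntegrable (fun t => (∑ j, c j * (y t j - x t j)) ^ 2) volume 0 T :=
    (hCη.pow 2).intervalIntegrable
  have hP : IntervalIntegrable (fun t => (-∑ j, b j * p t j) ^ 2 +
      (∑ j, c j * x t j - z 0) ^ 2) volume 0 T :=
    Continuous.intervalIntegrable (by fun_prop) _ _
  rw [cost_rowMatrix, cost_rowMatrix, ← mul_add]
  simp only [adjointControl_apply]
  congr 1
  have hadd := intervalIntegral.integral_add (hP.add (hw2.add hη2)) (hci.const_mul 2)
  rw [intervalIntegral.integral_const_mul, hcross, mul_zero, add_zero] at hadd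
  rw [← intervalIntegral.integral_add hP (hw2.add hη2), ← hadd]
  congr 1
  ext s
  simp only [mul_sub, Finset.sum_sub_distrib]
  ring

theorem IsHamiltonian.isOptimalPair (h : IsHamiltonian a b c (z 0) x p) (hT : 0 ≤ T)
    (hp : p T = 0) :
    IsOptimalPair (Matrix.diagonal a) (colMatrix b) (rowMatrix c) (WithLp.toLp 2 (x 0)) z T
      (adjointControl b p) (fun t => WithLp.toLp 2 (x t)) := by
  refine ⟨h.isTrajectory hT, fun v y hv => ?_⟩
  rw [(h.cost_eq hT hp hv).2.2]
  have : 0 ≤ ∫ t in (0 : ℝ)..T, ((v t 0 + ∑ j, b j * p t j) ^ 2 +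
        (∑ j, c j * (y t j - x t j)) ^ 2) :=
    intervalIntegral.integral_nonneg hT fun _ _ => by positivity
  linarith

theorem IsHamiltonian.eq_of_isOptimalPair (h : IsHamiltonian a b c (z 0) x p) (hT : 0 ≤ T)
    (hp : p T = 0) {v : ℝ → EuclideanSpace ℝ (Fin 1)} {y : ℝ → EuclideanSpace ℝ (Fin n)}
    (hv : IsOptimalPair (Matrix.diagonal a) (colMatrix b) (rowMatrix c) (WithLp.toLp 2 (x 0)) z T
      v y) :
    (∀ᵐ t ∂(volume.restrict (Ioo 0 T)), v t 0 = -∑ j, b j * p t j) ∧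
      ∀ t ∈ Icc 0 T, ∀ i, y t i = x t i := by
  obtain ⟨hw2, hη2, hcost⟩ := h.cost_eq hT hp hv.1
  have hle := hv.2 _ _ (h.isTrajectory hT)
  rw [hcost, intervalIntegral.integral_add hw2 hη2] at hle
  have h0 : 0 ≤ ∫ t in (0 : ℝ)..T, (∑ j, c j * (y t j - x t j)) ^ 2 :=
    intervalIntegral.integral_nonneg hT fun _ _ => sq_nonneg _
  have h1 : 0 ≤ ∫ t in (0 : ℝ)..T, (v t 0 + ∑ j, b j * p t j) ^ 2 :=
    intervalIntegral.integral_nonneg hT fun _ _ => sq_nonneg _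
  have h2 : ∫ t in (0 : ℝ)..T, (v t 0 + ∑ j, b j * p t j) ^ 2 = 0 := by linarith
  rw [intervalIntegral.integral_of_le hT, integral_eq_zero_iff_of_nonneg
    (fun _ => sq_nonneg _) hw2.1] at h2
  have hae : ∀ᵐ t ∂(volume.restrict (Ioc 0 T)), v t 0 + ∑ j, b j * p t j = 0 := by
    filter_upwards [h2] with t ht
    simpa using ht
  refine ⟨?_, fun t ht i => ?_⟩
  · filter_upwards [ae_mono (Measure.restrict_mono Ioo_subset_Ioc_self le_rfl) hae] with t ht
    linarith
  · obtain ⟨hv2, hyc, hy⟩ := (isTrajectory_iff hT).1 hv.1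
    obtain ⟨-, -, hx⟩ := (isTrajectory_iff hT).1 (h.isTrajectory hT)
    refine sub_eq_zero.1 (eq_zero_of_eq_integral (a := a i) (η := fun t => y t i - x t i)
      ((hyc i).sub (h.continuous_state i).continuousOn) (fun s hs => ?_) t ht)
    have i1 : IntervalIntegrable (fun r => y r i) volume 0 s :=
      ContinuousOn.intervalIntegrable
        (by rw [uIcc_of_le hs.1]; exact (hyc i).mono (Icc_subset_Icc_right hs.2))
    have hxc := h.continuous_state i
    have hβ := h.continuous_input
    have e : ∫ r in (0 : ℝ)..s, (a i * y r i + b i * v r 0) =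
        ∫ r in (0 : ℝ)..s, (a i * y r i + b i * -∑ j, b j * p r j) := by
      refine intervalIntegral.integral_congr_ae ?_
      rw [uIoc_of_le hs.1, ← ae_restrict_iff' measurableSet_Ioc]
      filter_upwards [ae_mono (Measure.restrict_mono (Ioc_subset_Ioc_right hs.2) le_rfl) hae]
        with r hr
      rw [eq_neg_of_add_eq_zero_left hr]
    have e1 := hy i s hs
    have e2 := hx i s hs
    simp only [adjointControl_apply] at e1 e2
    rw [e1, e2, e, add_sub_add_left_eq_sub, ← intervalIntegral.integral_sub
      ((i1.const_mul _).add (Continuous.intervalIntegrable (by fun_prop) _ _))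
      (Continuous.intervalIntegrable (by fun_prop) _ _)]
    congr 1
    ext r
    ring

end Optimality

/-! ### Steady minimizers -/

section Steady

variable {n : ℕ} {a b c : Fin n → ℝ}

/-- The multiplier must vanish on unobserved modes, as the time-dependent adjoint does. `hQ`
excludes the obstruction: a mode with `c i = a i = 0` and `b i ≠ 0` forces `u = 0` and may need a
nonzero multiplier. -/
theorem exists_steady_hamiltonian
    (hQ : ∀ i, c i = 0 → b i ≠ 0 → a i ≠ 0) (z : ℝ) :
    ∃ (u : ℝ) (x p : Fin n → ℝ), (∀ i, a i * x i + b i * u = 0) ∧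
      (∀ i, a i * p i + c i * (∑ j, c j * x j - z) = 0) ∧ u = -∑ j, b j * p j ∧
      ∀ i, c i = 0 → p i = 0 := by
  by_cases h0 : ∃ i, c i ≠ 0 ∧ a i = 0
  · obtain ⟨i, hc, hai⟩ := h0
    -- An observed neutral mode reaches the target exactly, at cost 0, so the multiplier is 0.
    refine ⟨0, Pi.single i (z / c i), 0, fun j => ?_, fun j => ?_, by simp, fun _ _ => rfl⟩
    · rcases eq_or_ne j i with rfl | hj
      · simp [hai]
      · simp [hj]
    · have : ∑ k, c k * (Pi.single i (z / c i) : Fin n → ℝ) k = z := by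
        rw [Finset.sum_eq_single i (fun k _ hk => by simp [hk]) (by simp)]
        simp only [Pi.single_eq_same]
        field_simp
      simp [this]
  · push Not at h0
    -- Steady gain from control to observation; `u` minimizes `u ^ 2 + (G * u - z) ^ 2`. If `a j =
    -- 0` then `c j = b j = 0` here, so the convention `r / 0 = 0` does no harm.
    set G := -∑ j, c j * b j / a j with hG
    set u := G * z / (1 + G ^ 2) with hu
    have hG1 : 1 + G ^ 2 ≠ 0 := by positivity
    have hCx : ∑ j, c j * (-(b j * u) / a j) = G * u := by
      rw [hG, neg_mul, Finset.sum_mul, ← Finset.sum_neg_distrib]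
      exact Finset.sum_congr rfl fun j _ => by ring
    refine ⟨u, fun i => -(b i * u) / a i, fun i => -(c i * (G * u - z)) / a i, fun i => ?_,
      fun i => ?_, ?_, fun i hi => by simp [hi]⟩
    · by_cases hai : a i = 0
      · have hb : b i = 0 := by
          by_contra hb
          exact hQ i (by_contra fun hc => h0 i hc hai) hb hai
        simp [hai, hb]
      · field_simp
        ring
    · rw [hCx]
      by_cases hai : a i = 0
      · have hc : c i = 0 := by_contra fun hc => h0 i hc hai
        simp [hai, hc]
      · field_simp
        ring
    · have : ∑ j, b j * (-(c j * (G * u - z)) / a j) = G * (G * u - z) := by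
        conv_rhs => rw [hG, neg_mul, Finset.sum_mul, ← Finset.sum_neg_distrib]
        rw [← hG]
        exact Finset.sum_congr rfl fun j _ => by ring
      rw [this]
      have : u * (1 + G ^ 2) = G * z := by rw [hu]; field_simp
      linarith

theorem eq_of_isSteadyMinimizer (ha : Function.Injective a)
    {z : EuclideanSpace ℝ (Fin 1)} {u : ℝ} {x p : Fin n → ℝ}
    (hx : ∀ i, a i * x i + b i * u = 0)
    (hp : ∀ i, a i * p i + c i * (∑ j, c j * x j - z 0) = 0) (hu : u = -∑ j, b j * p j)
    {v : EuclideanSpace ℝ (Fin 1)} {y : EuclideanSpace ℝ (Fin n)}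
    (hv : IsSteadyMinimizer (Matrix.diagonal a) (colMatrix b) (rowMatrix c) z v y) :
    v 0 = u ∧ ∀ i, c i ≠ 0 ∨ a i < 0 → y i = x i := by
  have hadm : ∀ i, a i * y i + b i * v 0 = 0 := fun i => by
    have := congrArg (fun w => w i) hv.1
    simpa [act_diagonal_apply, act_colMatrix_apply] using this
  have hle := hv.2 (WithLp.toLp 2 fun _ => u) (WithLp.toLp 2 x) (by
    ext i
    rw [PiLp.add_apply, act_diagonal_apply, act_colMatrix_apply]
    exact hx i)
  rw [steadyCost_rowMatrix, steadyCost_rowMatrix] at hle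
  simp only at hle
  have hcross : (∑ j, c j * x j - z 0) * (∑ j, c j * (y j - x j)) + u * (v 0 - u) = 0 := by
    have e : ∀ j, (∑ j, c j * x j - z 0) * (c j * (y j - x j)) = (b j * p j) * (v 0 - u) := by
      intro j
      linear_combination (y j - x j) * hp j - p j * hadm j + p j * hx j
    rw [Finset.mul_sum, Finset.sum_congr rfl fun j _ => e j, ← Finset.sum_mul]
    linear_combination (v 0 - u) * hu
  have hsub : ∑ j, c j * (y j - x j) = ∑ j, c j * y j - ∑ j, c j * x j := by
    simp only [mul_sub, Finset.sum_sub_distrib]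
  have hsq : (v 0 - u) ^ 2 + (∑ j, c j * (y j - x j)) ^ 2 ≤ 0 := by
    rw [hsub] at hcross ⊢
    nlinarith
  have hw : v 0 = u := by
    have : (v 0 - u) ^ 2 = 0 := by
      nlinarith [sq_nonneg (v 0 - u), sq_nonneg (∑ j, c j * (y j - x j))]
    exact sub_eq_zero.1 (pow_eq_zero_iff two_ne_zero |>.1 this)
  have hC : ∑ j, c j * (y j - x j) = 0 := by
    have : (∑ j, c j * (y j - x j)) ^ 2 = 0 := by
      nlinarith [sq_nonneg (v 0 - u), sq_nonneg (∑ j, c j * (y j - x j))]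
    exact pow_eq_zero_iff two_ne_zero |>.1 this
  have haη : ∀ i, a i ≠ 0 → y i = x i := fun i hai => by
    have h1 := hadm i
    rw [hw] at h1
    exact mul_left_cancel₀ hai (by linarith [hx i])
  refine ⟨hw, fun i hi => ?_⟩
  -- The constraint leaves `y i` free if `a i = 0`, but at most one index has this; all other
  -- coordinates agree, so equality of the outputs determines this one.
  by_cases hai : a i = 0
  · have hc : c i ≠ 0 := hi.resolve_right (by simp [hai])
    rw [Finset.sum_eq_single i (fun j _ hj => by
      rw [haη j fun haj => hj (ha (haj.trans hai.symm)), sub_self, mul_zero]) (by simp)] at hC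
    exact sub_eq_zero.1 ((mul_eq_zero.1 hC).resolve_left hc)
  · exact haη i hai

end Steady

/-! ### The detectable projection of a diagonal system -/

section Detectable

variable {n : ℕ} {a c : Fin n → ℝ}

theorem act_rowMatrix_mul_diagonal_pow_apply (k : ℕ) (x : EuclideanSpace ℝ (Fin n)) (i : Fin 1) :
    act (rowMatrix c * Matrix.diagonal a ^ k) x i = ∑ j, (c j * x j) * a j ^ k := by
  have : rowMatrix c * Matrix.diagonal a ^ k = rowMatrix fun j => c j * a j ^ k := by
    ext i j
    simp [Matrix.diagonal_pow, Matrix.mul_diagonal, rowMatrix]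
  rw [this, act_rowMatrix_apply]
  exact Finset.sum_congr rfl fun j _ => by ring

theorem mul_eq_zero_of_mem_unobservable (ha : Function.Injective a)
    {x : EuclideanSpace ℝ (Fin n)} (hx : x ∈ unobservable (Matrix.diagonal a) (rowMatrix c))
    (i : Fin n) : c i * x i = 0 := by
  have : (fun j => c j * x j) = 0 := by
    refine Matrix.eq_zero_of_forall_pow_sum_mul_pow_eq_zero ha fun k => ?_
    have h := (Submodule.mem_iInf _).1 hx k
    rw [LinearMap.mem_ker] at h
    rw [← act_rowMatrix_mul_diagonal_pow_apply (k : ℕ) x 0, h]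
    rfl
  exact congrFun this i

theorem single_mem_undetectable {i : Fin n} (hc : c i = 0) (ha : 0 ≤ a i) :
    EuclideanSpace.single i (1 : ℝ) ∈ undetectable (Matrix.diagonal a) (rowMatrix c) := by
  refine ⟨(Submodule.mem_iInf _).2 fun k => ?_, ?_⟩
  · rw [LinearMap.mem_ker]
    ext l
    rw [act_rowMatrix_mul_diagonal_pow_apply, Finset.sum_eq_single i
      (fun j _ hj => by simp [hj]) (by simp)]
    simp [hc]
  · change complexify n (EuclideanSpace.single i 1) ∈ ⨆ μ : {μ : ℂ // 0 ≤ μ.re},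
      Module.End.maxGenEigenspace (Matrix.toLin' ((Matrix.diagonal a).map Complex.ofReal)) (μ : ℂ)
    refine Submodule.mem_iSup_of_mem (⟨(a i : ℂ), by simpa using ha⟩ : {μ : ℂ // 0 ≤ μ.re}) ?_
    refine Module.End.mem_maxGenEigenspace _ _ _ |>.2 ⟨1, ?_⟩
    have : complexify n (EuclideanSpace.single i 1) = Pi.single i 1 := by
      ext j
      rcases eq_or_ne j i with rfl | hj
      · simp [complexify]
      · simp [complexify, hj]
    rw [this, pow_one]
    ext j
    rcases eq_or_ne j i with rfl | hj
    · simp [Matrix.mulVec_single]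
    · simp [Matrix.mulVec_single, hj]

/-- Coordinates with `c i = 0` and `0 ≤ a i` are undetectable: deleting them leaves the projection
unchanged, and the projection is a contraction. -/
theorem norm_detectableProj_sq_le {x : EuclideanSpace ℝ (Fin n)} {m : ℝ} (hm : 0 ≤ m)
    (h : ∀ i, c i ≠ 0 ∨ a i < 0 → x i ^ 2 ≤ m) :
    ‖detectableProj (Matrix.diagonal a) (rowMatrix c) x‖ ^ 2 ≤ n * m := by
  classical
  set U := undetectable (Matrix.diagonal a) (rowMatrix c) with hU
  set y : EuclideanSpace ℝ (Fin n) :=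
    WithLp.toLp 2 fun i => if c i ≠ 0 ∨ a i < 0 then x i else 0 with hy
  have hsub : x - y ∈ U := by
    have : x - y = ∑ i, (x - y) i • EuclideanSpace.single i (1 : ℝ) := by
      ext j
      simp [Pi.single_apply]
    rw [this]
    refine Submodule.sum_mem _ fun i _ => ?_
    by_cases hi : c i ≠ 0 ∨ a i < 0
    · simp [hy, hi]
    · push Not at hi
      exact Submodule.smul_mem _ _ (single_mem_undetectable hi.1 hi.2)
  have hD : detectableProj (Matrix.diagonal a) (rowMatrix c) x =
      detectableProj (Matrix.diagonal a) (rowMatrix c) y := by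
    rw [← sub_eq_zero, ← map_sub]
    exact (Submodule.starProjection_apply_eq_zero_iff _).2 (by
      rwa [Submodule.orthogonal_orthogonal])
  rw [hD]
  calc ‖detectableProj (Matrix.diagonal a) (rowMatrix c) y‖ ^ 2 ≤ ‖y‖ ^ 2 := by
        gcongr
        exact Submodule.norm_starProjection_apply_le _ _
    _ = ∑ i, y i ^ 2 := EuclideanSpace.real_norm_sq_eq _
    _ ≤ ∑ _i : Fin n, m := by
        refine Finset.sum_le_sum fun i _ => ?_
        by_cases hi : c i ≠ 0 ∨ a i < 0
        · simpa [hy, hi] using h i hi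
        · simpa [hy, hi] using hm
    _ = n * m := by simp

/-- By a Vandermonde argument with the distinct `a i`, unobservable vectors vanish at observed
coordinates, so the basis vector is detectable and fixed by the projection. -/
theorem abs_le_norm_detectableProj (ha : Function.Injective a) {i : Fin n} (hc : c i ≠ 0)
    (x : EuclideanSpace ℝ (Fin n)) :
    |x i| ≤ ‖detectableProj (Matrix.diagonal a) (rowMatrix c) x‖ := by
  set U := undetectable (Matrix.diagonal a) (rowMatrix c) with hU
  have hmem : EuclideanSpace.single i (1 : ℝ) ∈ Uᗮ := by
    rw [Submodule.mem_orthogonal]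
    intro y hy
    have := (mul_eq_zero.1 (mul_eq_zero_of_mem_unobservable ha hy.1 i)).resolve_left hc
    rw [EuclideanSpace.inner_single_right, this, one_mul, map_zero]
  have h1 : inner ℝ (EuclideanSpace.single i (1 : ℝ)) (Uᗮ.starProjection x) = x i := by
    rw [← Submodule.inner_starProjection_left_eq_right,
      Submodule.starProjection_eq_self_iff.2 hmem,
      EuclideanSpace.inner_single_left, map_one, one_mul]
  have h2 := abs_real_inner_le_norm (EuclideanSpace.single i (1 : ℝ)) (Uᗮ.starProjection x)
  rwa [h1, PiLp.norm_single, norm_one, one_mul] at h2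

end Detectable

/-! ### The turnpike property of diagonal systems -/

theorem CTurnpike.control_ne_zero_or_neg {n : ℕ} {a b c : Fin n → ℝ} (ha : Function.Injective a)
    (h : CTurnpike (Matrix.diagonal a) (colMatrix b) (rowMatrix c)) :
    ∀ i, c i ≠ 0 → b i ≠ 0 ∨ a i < 0 := by
  intro i hc
  by_contra! hcon
  obtain ⟨hb, hai⟩ := hcon
  obtain ⟨μ, hμ, h⟩ := h
  obtain ⟨K, hK⟩ := h (EuclideanSpace.single i 1) 0
  have hsteady : IsSteadyMinimizer (Matrix.diagonal a) (colMatrix b) (rowMatrix c)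
      (0 : EuclideanSpace ℝ (Fin 1)) 0 0 := by
    refine ⟨by simp, fun v y _ => ?_⟩
    simp only [steadyCost, map_zero, sub_zero, norm_zero]
    norm_num
    positivity
  have key : ∀ T : ℝ, 0 < T → 1 ≤ 2 * |K| * Real.exp (-(μ / 3) * T) := by
    intro T hT
    obtain ⟨x, p, hH, hx0, hpT⟩ := exists_isHamiltonian a b c hT.le
      (fun j => EuclideanSpace.single i (1 : ℝ) j) 0
    have hopt := IsHamiltonian.isOptimalPair (z := 0) hH hT.le hpT
    rw [hx0] at hopt
    have hae := hK T hT _ _ hopt 0 0 hsteady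
    -- The bound holds only almost everywhere; the middle third has positive measure, and both
    -- exponentials are small there.
    have hpos : (volume.restrict (Ioo 0 T)) (Ioo (T / 3) (2 * T / 3)) ≠ 0 := by
      rw [Measure.restrict_apply measurableSet_Ioo, inter_eq_left.2
        (Ioo_subset_Ioo (by linarith) (by linarith)), Real.volume_Ioo]
      simp only [ne_eq, ENNReal.ofReal_eq_zero, not_le]
      linarith
    obtain ⟨t, ht, hbound⟩ := (frequently_ae_mem_iff.2 hpos).and_eventually hae |>.exists
    have hxi : x t i = Real.exp (a i * t) := by
      rw [eq_exp_mul_of_hasDerivAt (a := a i) (f := fun t => x t i)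
        (fun s => (hH.state i s).congr_deriv (by simp [hb])) t, hx0]
      simp
    have h1 : 1 ≤ x t i := by
      rw [hxi]
      exact Real.one_le_exp (mul_nonneg hai (by linarith [ht.1]))
    have h2 := abs_le_norm_detectableProj ha hc (WithLp.toLp 2 (x t))
    rw [map_zero, sub_zero, sub_zero] at hbound
    have e1 : Real.exp (-μ * t) ≤ Real.exp (-(μ / 3) * T) :=
      Real.exp_le_exp.2 (by nlinarith [ht.1])
    have e2 : Real.exp (-μ * (T - t)) ≤ Real.exp (-(μ / 3) * T) :=
      Real.exp_le_exp.2 (by nlinarith [ht.2])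
    calc (1 : ℝ) ≤ |x t i| := h1.trans (le_abs_self _)
      _ ≤ K * (Real.exp (-μ * t) + Real.exp (-μ * (T - t))) :=
          (h2.trans (le_add_of_nonneg_left (norm_nonneg _))).trans hbound
      _ ≤ |K| * (Real.exp (-(μ / 3) * T) + Real.exp (-(μ / 3) * T)) :=
          mul_le_mul (le_abs_self K) (add_le_add e1 e2) (by positivity) (abs_nonneg K)
      _ = _ := by ring
  have hlim : Filter.Tendsto (fun T : ℝ => 2 * |K| * Real.exp (-(μ / 3) * T)) Filter.atTop
      (nhds (2 * |K| * 0)) := by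
    refine Filter.Tendsto.const_mul _ (Real.tendsto_exp_atBot.comp ?_)
    exact Filter.tendsto_id.const_mul_atTop_of_neg (by linarith)
  have := ge_of_tendsto hlim ((Filter.eventually_gt_atTop 0).mono key)
  linarith

theorem IsHamiltonian.sub_steady {n : ℕ} {a b c : Fin n → ℝ} {z u : ℝ} {X P : ℝ → Fin n → ℝ}
    {x p : Fin n → ℝ} (h : IsHamiltonian a b c z X P) (hx : ∀ i, a i * x i + b i * u = 0)
    (hp : ∀ i, a i * p i + c i * (∑ j, c j * x j - z) = 0) (hu : u = -∑ j, b j * p j) :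
    IsHamiltonian a b c 0 (fun t => X t - x) (fun t => P t - p) := by
  constructor
  · intro i t
    refine ((h.state i t).sub_const (x i)).congr_deriv ?_
    simp only [Pi.sub_apply, mul_sub, Finset.sum_sub_distrib]
    linear_combination hx i - b i * hu
  · intro i t
    refine ((h.adjoint i t).sub_const (p i)).congr_deriv ?_
    simp only [Pi.sub_apply, mul_sub, Finset.sum_sub_distrib]
    linear_combination -hp i

theorem IsHamiltonian.adjoint_eq_zero_of_unobserved {n : ℕ} {a b c : Fin n → ℝ} {z T : ℝ}
    {x p : ℝ → Fin n → ℝ} (h : IsHamiltonian a b c z x p) (hp : p T = 0) {i : Fin n}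
    (hc : c i = 0) (t : ℝ) : p t i = 0 := by
  have he := eq_exp_mul_of_hasDerivAt (a := -a i) (f := fun t => p t i)
    (fun s => (h.adjoint i s).congr_deriv (by simp [hc]))
  have h0 : p 0 i = 0 := by
    have := he T
    simp only [hp, Pi.zero_apply] at this
    exact (mul_eq_zero.1 this.symm).resolve_left (Real.exp_pos _).ne'
  rw [he t, h0, mul_zero]

theorem exists_rate_le {n : ℕ} (a : Fin n → ℝ) {ν₀ : ℝ} (hν₀ : 0 < ν₀) :
    ∃ ν, 0 < ν ∧ ν ≤ ν₀ ∧ ∀ i, a i < 0 → ν ≤ -a i / 2 := by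
  have h : ∀ᶠ ν in nhdsWithin (0 : ℝ) (Ioi 0), 0 < ν ∧ ν ≤ ν₀ ∧ ∀ i, a i < 0 → ν ≤ -a i / 2 := by
    refine (eventually_mem_nhdsWithin (s := Ioi (0 : ℝ))).and
      (Filter.Eventually.and ?_ (Filter.eventually_all.2 fun i => ?_))
    · exact Filter.Eventually.filter_mono nhdsWithin_le_nhds (eventually_le_nhds hν₀)
    · by_cases hi : a i < 0
      · exact Filter.Eventually.mono (Filter.Eventually.filter_mono nhdsWithin_le_nhds
          (eventually_le_nhds (by linarith : (0 : ℝ) < -a i / 2))) fun ν hν _ => hν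
      · exact Filter.Eventually.of_forall fun ν h => absurd h hi
  exact h.exists

theorem sqrt_exp_add_exp_le (ν t T : ℝ) :
    √(Real.exp (-ν * t) + Real.exp (-ν * (T - t))) ≤
      Real.exp (-(ν / 2) * t) + Real.exp (-(ν / 2) * (T - t)) := by
  have e : ∀ s, Real.exp (-ν * s) = Real.exp (-(ν / 2) * s) ^ 2 := fun s => by
    rw [← Real.exp_nat_mul]
    congr 1
    push_cast
    ring
  rw [e t, e (T - t), Real.sqrt_le_left (by positivity)]
  nlinarith [mul_pos (Real.exp_pos (-(ν / 2) * t)) (Real.exp_pos (-(ν / 2) * (T - t)))]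

theorem cTurnpike_of_control_ne_zero_or_neg {n : ℕ} {a b c : Fin n → ℝ}
    (ha : Function.Injective a) (hQ : ∀ i, c i = 0 → b i ≠ 0 → a i ≠ 0)
    (hP : ∀ i, c i ≠ 0 → b i ≠ 0 ∨ a i < 0) :
    CTurnpike (Matrix.diagonal a) (colMatrix b) (rowMatrix c) := by
  obtain ⟨ν₀, hν₀, K₀, hK₀, hexp⟩ := exists_wsq_le_exp ha hP
  obtain ⟨ν, hν, hνν₀, hνa⟩ := exists_rate_le a hν₀
  -- The decay at rate `ν` is for squares; taking roots halves it.
  refine ⟨ν / 2, by positivity, fun x₀ z => ?_⟩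
  obtain ⟨ubar, xbar, pbar, hx, hp, hu, hp0⟩ := exists_steady_hamiltonian hQ (z 0)
  -- Boundary data of the difference: the adjoint there ends at `0 - pbar`. Nothing in `ρ` depends
  -- on `T`.
  set ρ := wsq c (fun i => x₀ i - xbar i) + wsq b pbar with hρ
  have hρ1 := wsq_nonneg c (fun i => x₀ i - xbar i)
  have hρ2 := wsq_nonneg b pbar
  have hρ0 : 0 ≤ ρ := add_nonneg hρ1 hρ2
  -- One summand for each case: the first serves observed coordinates, the second unobserved stable
  -- ones.
  set L : Fin n → ℝ := fun i => (c i)⁻¹ ^ 2 * (K₀ * ρ) +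
    ((x₀ i - xbar i) ^ 2 + 4 * ((b i) ^ 2 * (n * (K₀ * ρ))) / a i ^ 2) with hL
  have hL0 : ∀ i, 0 ≤ L i := fun i => by positivity
  have hLs : ∀ i, L i ≤ ∑ i, L i := fun i =>
    Finset.single_le_sum (fun i _ => hL0 i) (Finset.mem_univ i)
  have hLs0 : 0 ≤ ∑ i, L i := Finset.sum_nonneg fun i _ => hL0 i
  refine ⟨√(n * (K₀ * ρ)) + √(n * ∑ i, L i), fun T hT u x hopt v y hsteady => ?_⟩
  obtain ⟨X, P, hH, hX0, hPT⟩ := exists_isHamiltonian a b c hT.le (fun i => x₀ i) (z 0)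
  have hopt' : IsOptimalPair (Matrix.diagonal a) (colMatrix b) (rowMatrix c)
      (WithLp.toLp 2 (X 0)) z T u x := by rw [hX0]; exact hopt
  obtain ⟨hu_eq, hx_eq⟩ := hH.eq_of_isOptimalPair hT.le hPT hopt'
  obtain ⟨hv, hy⟩ := eq_of_isSteadyMinimizer ha hx hp hu hsteady
  have hD := hH.sub_steady hx hp hu
  have hq0 : ∀ i t, c i = 0 → (P t - pbar) i = 0 := fun i t hc => by
    rw [Pi.sub_apply, hH.adjoint_eq_zero_of_unobserved hPT hc, hp0 i hc, sub_zero]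
  have hx0 : wsq c (X 0 - xbar) ≤ ρ := by
    rw [hX0]
    exact le_add_of_nonneg_right hρ2
  have hqT : wsq b (P T - pbar) ≤ ρ := by
    have : wsq b (P T - pbar) = wsq b pbar := by simp [wsq, hPT]
    rw [this]
    exact le_add_of_nonneg_left hρ1
  set S : ℝ → ℝ := fun t => Real.exp (-ν * t) + Real.exp (-ν * (T - t)) with hS
  have hS0 : ∀ t, 0 < S t := fun t => by positivity
  have hM : ∀ t ∈ Icc 0 T, wsq c (X t - xbar) + wsq b (P t - pbar) ≤ K₀ * ρ * S t := by
    intro t ht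
    refine (hexp T ρ hT _ _ hD hq0 hx0 hqT t ht).trans ?_
    have h1 : 0 ≤ t := ht.1
    have h2 : 0 ≤ T - t := sub_nonneg.2 ht.2
    simp only [hS]
    gcongr
  have hβ : ∀ t ∈ Icc 0 T, (∑ j, b j * (P t - pbar) j) ^ 2 ≤ n * (K₀ * ρ) * S t := by
    intro t ht
    refine (sum_sq_le_wsq _ _).trans ?_
    rw [mul_assoc (n : ℝ)]
    gcongr
    linarith [hM t ht, wsq_nonneg c (X t - xbar)]
  have hcoord : ∀ t ∈ Icc 0 T, ∀ i, c i ≠ 0 ∨ a i < 0 →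
      (X t i - xbar i) ^ 2 ≤ (∑ i, L i) * S t := by
    intro t ht i hi
    refine le_trans ?_ (mul_le_mul_of_nonneg_right (hLs i) (hS0 t).le)
    by_cases hc : c i = 0
    · have hai := hi.resolve_left (not_not.2 hc)
      have h1 := sq_le_exp_of_stable hν (hνa i hai) (f := fun t => X t i - xbar i)
        (g := fun t => -b i * ∑ j, b j * (P t - pbar) j) (T := T)
        (K := b i ^ 2 * (n * (K₀ * ρ)))
        (fun s => (hD.state i s).congr_deriv (by simp only [Pi.sub_apply]; ring))
        (fun s hs => by
          rw [mul_pow, neg_sq, mul_assoc]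
          exact mul_le_mul_of_nonneg_left (hβ s hs) (sq_nonneg _)) (by positivity) t ht
      refine h1.trans (mul_le_mul_of_nonneg_right ?_ (hS0 t).le)
      rw [hX0]
      exact le_add_of_nonneg_left (by positivity)
    · have h1 := (sq_le_wsq c (X t - xbar) i).trans
        ((le_add_of_nonneg_right (wsq_nonneg b (P t - pbar))).trans (hM t ht))
      calc (X t i - xbar i) ^ 2 = (c i)⁻¹ ^ 2 * (c i * (X t - xbar) i) ^ 2 := by
            simp only [Pi.sub_apply]; field_simp
        _ ≤ (c i)⁻¹ ^ 2 * (K₀ * ρ * S t) := by gcongr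
        _ ≤ L i * S t := by
            rw [← mul_assoc]
            refine mul_le_mul_of_nonneg_right ?_ (hS0 t).le
            exact le_add_of_nonneg_right (by positivity)
  filter_upwards [hu_eq, ae_restrict_mem measurableSet_Ioo] with t hut ht
  have htI := Ioo_subset_Icc_self ht
  have hnu : ‖u t - v‖ ≤ √(n * (K₀ * ρ)) * √(S t) := by
    rw [norm_fin_one, PiLp.sub_apply, hut, hv, hu, ← Real.sqrt_mul (by positivity)]
    refine Real.abs_le_sqrt ((le_of_eq ?_).trans (hβ t htI))
    simp only [Pi.sub_apply, mul_sub, Finset.sum_sub_distrib]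
    ring
  have hnx : ‖detectableProj (Matrix.diagonal a) (rowMatrix c) (x t) -
      detectableProj (Matrix.diagonal a) (rowMatrix c) y‖ ≤ √(n * ∑ i, L i) * √(S t) := by
    rw [← map_sub, ← Real.sqrt_mul (by positivity)]
    refine Real.le_sqrt_of_sq_le ?_
    rw [mul_assoc]
    refine norm_detectableProj_sq_le (mul_nonneg hLs0 (hS0 t).le) fun i hi => ?_
    rw [PiLp.sub_apply, hx_eq t htI i, hy i hi]
    exact hcoord t htI i hi
  calc _ ≤ √(n * (K₀ * ρ)) * √(S t) + √(n * ∑ i, L i) * √(S t) := add_le_add hnu hnx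
    _ = (√(n * (K₀ * ρ)) + √(n * ∑ i, L i)) * √(S t) := by ring
    _ ≤ _ := by
        gcongr
        exact sqrt_exp_add_exp_le ν t T

/-! ### The heat equation -/

/-- Two eigenfunctions with the same eigenvalue lie on one line, so they are proportional, against
orthonormality. -/
theorem IsEigenbasis.injective {d : ℕ} {Ω : Set (EuclideanSpace ℝ (Fin d))} {c : Lp ℝ ∞ (vol Ω)}
    {lam : ℕ → ℝ} {φ : ℕ → EuclideanSpace ℝ (Fin d) → ℝ} (h : IsEigenbasis Ω c lam φ)
    (hsimple : HasSimpleSpectrum Ω c) : Function.Injective lam := by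
  obtain ⟨hspec, -, e, -, heig, horth, -⟩ := h
  intro i j hij
  by_contra hne
  have hmem : ∀ k, lam k = lam i → e k ∈ LinearMap.ker (shifted Ω c (lam i)) := fun k hk => by
    rw [LinearMap.mem_ker, shifted, LinearMap.sub_apply, LinearMap.smul_apply, heig k, hk, sub_self]
  have hfin := hsimple (lam i) (hspec ▸ mem_range_self i)
  obtain ⟨r, hr⟩ := exists_smul_eq_of_finrank_eq_one hfin (x := ⟨e i, hmem i rfl⟩)
    (fun h0 => horth.ne_zero i (by
      have : e i = 0 := congrArg Subtype.val h0
      simp [this])) ⟨e j, hmem j hij.symm⟩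
  have hr' : r • e i = e j := congrArg Subtype.val hr
  have h1 : inner ℝ (toL2 Ω (e i)) (toL2 Ω (e j)) = 0 := horth.2 hne
  rw [← hr', map_smul, inner_smul_right, real_inner_self_eq_norm_sq, horth.1 i] at h1
  have hr0 : r = 0 := by simpa using h1
  refine horth.ne_zero j ?_
  rw [← hr', hr0, zero_smul, map_zero]

end PointHeat

theorem proposition1p2
    {d : ℕ} (hd : 1 ≤ d ∧ d ≤ 3)
    (Ω : Set (EuclideanSpace ℝ (Fin d)))
    (hΩ_open : IsOpen Ω) (hΩ_bdd : Bornology.IsBounded Ω) (hΩ_conn : IsConnected Ω)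
    (hΩ_smooth : PointHeat.HasSmoothBoundary Ω)
    (c : Lp ℝ ∞ (PointHeat.vol Ω))
    (hsimple : PointHeat.HasSimpleSpectrum Ω c)
    (lam : ℕ → ℝ) (φ : ℕ → EuclideanSpace ℝ (Fin d) → ℝ)
    (hφ : PointHeat.IsEigenbasis Ω c lam φ)
    (xcon xobs : EuclideanSpace ℝ (Fin d)) (hcon : xcon ∈ Ω) (hobs : xobs ∈ Ω)
    (N : ℕ) (hN : 0 < N) :
    (PointHeat.CTurnpike (PointHeat.heatA lam N) (PointHeat.heatB φ xcon N)
        (PointHeat.heatC φ xobs N) →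
      ∀ i : Fin N, φ i xobs ≠ 0 → φ i xcon ≠ 0 ∨ 0 < lam i) ∧
    ((∀ i : Fin N, φ i xobs = 0 → φ i xcon ≠ 0 → lam i ≠ 0) →
      (∀ i : Fin N, φ i xobs ≠ 0 → φ i xcon ≠ 0 ∨ 0 < lam i) →
      PointHeat.CTurnpike (PointHeat.heatA lam N) (PointHeat.heatB φ xcon N)
        (PointHeat.heatC φ xobs N)) := by
  have ha : Function.Injective fun i : Fin N => -lam i := fun i j hij =>
    Fin.ext (hφ.injective hsimple (neg_injective hij))
  refine ⟨fun h i hi => ?_, fun hQ hP => ?_⟩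
  · have := PointHeat.CTurnpike.control_ne_zero_or_neg
      (b := fun i : Fin N => φ i xcon) (c := fun i : Fin N => φ i xobs) ha h i hi
    simpa using this
  · exact PointHeat.cTurnpike_of_control_ne_zero_or_neg
      (b := fun i : Fin N => φ i xcon) (c := fun i : Fin N => φ i xobs) ha
      (fun i h1 h2 => neg_ne_zero.2 (hQ i h1 h2)) (fun i hi => by simpa using hP i hi)
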